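/- **Setting.** Write $|j\rangle$, $j\in\{0,1\}^n$, for the computational basis of $n$ qubits. Let $A$ be a Hermitian matrix on $n$ qubits with $\|A\|\le 1$ (operator norm) that is $d$-sparse (at most $d$ nonzero entries in each row), whose entries are represented exactly by $m$-bit strings in a known format. Access to $A$ is through the oracle that performs $$|j,k,z\rangle\mapsto|j,k,z\oplus A_{jk}\rangle,\qquad |j,l\rangle\mapsto|j,\mathrm{col}(j,l)\rangle,$$ where, for each row $j$, $\mathrm{col}(j,\cdot)$ is a permutation of $\{0,1\}^n$ whose first $d$ values (all of them, if $d>2^n$) include all columns in which row $j$ is nonzero (rows with fewer than $d$ nonzero entries are filled up with zero entries). A circuit alternates arbitrary unitaries that do not depend on $A$ with applications of the oracle or of its inverse to registers of qubits; each such application is one query. Let $f:[-1,1]\to\mathbb R$ be smooth, with derivatives bounded on $(-1,1)$: $|f^{(i)}(x)|\le C$ for all $i\ge1$ and all $x\in(-1,1)$, where $C>0$. Put $\alpha_i=f^{(i)}(0)/i!$ and $$\mu=\inf_{x\in[-1,1]}|f(x)|,\qquad \gamma=\sum_{i=0}^{L}d^i|\alpha_i| .$$ The matrix $f(A)$ is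 defined by the spectral decomposition of $A$. In (1) and (2), quotients are read as $0$ if $\gamma=0$; in (3), a normalized state is read as $0$ if the success probability is $0$. **Theorem 1.** There are absolute constants $K$ and $c$ such that the following holds for all $n,d,m$, every entry format, every such $f$ and $C$, every $\epsilon>0$ and every integer $L\ge0$ with $L>\log_2(C/\epsilon)$. There are a number $t$ of ancilla qubits and a circuit on $t+n$ qubits that makes at most $K L$ oracle queries and that is the same for all $A$ as above, all oracles for $A$ and all input states, such that, for every such $A$, every oracle for $A$ and every $n$-qubit state $|\psi\rangle$ (unit vector), the following holds. Let $U$ be the unitary that the circuit performs. Apply $U$ to $|0^t\rangle|\psi\rangle$ and measure the ancilla qubits; the outcome $0^t$ is the flag that signals success. Let $p=\big\|(\langle0^t|\otimes I)U|0^t\rangle|\psi\rangle\big\|^2$ be the probability of success and $|\tilde\psi\rangle=(\langle0^t|\otimes I)U|0^t\rangle|\psi\rangle/\sqrt p$ the state prepared in case of success. Then 1. $p\ge(\mu/\gamma)^2$; 2. $\sqrt p\ge\big(\|f(A)|\psi\rangle\|-\epsilon\big)/\gamma$; 3. if $f(A)|\psi\rangle\ne0$, then $$\left\|\,|\tilde\psi\rangle-\frac{f(A)|\psi\rangle}{\|f(A)|\psi\rangle\|}\right\|\le\frac{c\,\epsilon}{\|f(A)|\psi\rangle\|},$$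 which is at most $c\,\epsilon/\mu$ if $\mu>0$. -/

import Mathlib

open scoped ContDiff

noncomputable section

/-- Bit strings of length `n`, indexing the computational basis of `n` qubits. Addition of bit
strings is bitwise addition modulo 2. -/
abbrev Bits (n : ℕ) : Type := Fin n → Fin 2

/-- The wires of a circuit with `t` ancilla qubits and `n` system qubits. -/
abbrev Wires (t n : ℕ) : Type := Fin t ⊕ Fin n

/-- The computational basis of `t` ancilla qubits together with `n` system qubits. -/
abbrev Basis (t n : ℕ) : Type := Wires t n → Fin 2

/-- Every row has at most `d` nonzero entries. -/
def IsRowSparse {n : ℕ} (d : ℕ) (A : Matrix (Bits n) (Bits n) ℂ) : Prop :=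
  ∀ j, {k | A j k ≠ 0}.ncard ≤ d

/-- Sparse access to a matrix `A` whose entries are represented exactly by `m`-bit strings, the
string `z` standing for the number `val z`.
* `entry j k` is the string written by the entry oracle `|j, k, z⟩ ↦ |j, k, z ⊕ A_jk⟩`.
* `col j` is the action of the column oracle `|j, l⟩ ↦ |j, col(j, l)⟩` on its second register.
  It is a permutation, so that the oracle is unitary; its first `d` values enumerate `d` distinct
  columns among which are all those where row `j` is nonzero (if row `j` has fewer than `d` nonzero
  entries, the enumeration is filled up with zero entries). -/
structure SparseOracle {n m : ℕ} (d : ℕ) (val : Bits m → ℂ)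
    (A : Matrix (Bits n) (Bits n) ℂ) where
  entry : Bits n → Bits n → Bits m
  val_entry : ∀ j k, val (entry j k) = A j k
  col : Bits n → Equiv.Perm (Bits n)
  nonzero_mem : ∀ j k, A j k ≠ 0 → ∃ l : Bits n, (finFunctionFinEquiv l : ℕ) < d ∧ col j l = k

/-- The gates of a circuit on `t + n` qubits with oracle access:
* a fixed unitary, which does not involve the oracle;
* the entry oracle, applied to the wires `r` that hold the registers `j`, `k`, `z`;
* the column oracle (or its inverse, if `inv` is true), applied to the wires `r` that hold the
  registers `j`, `l`. -/
inductive Gate (n m t : ℕ) : Type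
  | free (V : Matrix.unitaryGroup (Basis t n) ℂ) : Gate n m t
  | entryQuery (r : (Fin n ⊕ Fin n) ⊕ Fin m ↪ Wires t n) : Gate n m t
  | colQuery (r : Fin n ⊕ Fin n ↪ Wires t n) (inv : Bool) : Gate n m t

/-- The number of oracle queries made by one gate. -/
def Gate.queries {n m t : ℕ} : Gate n m t → ℕ
  | .free _ => 0
  | .entryQuery _ => 1
  | .colQuery _ _ => 1

/-- The number of oracle queries made by a circuit. -/
def queryCount {n m t : ℕ} (c : List (Gate n m t)) : ℕ := (c.map Gate.queries).sum

/-- Overwrite the wires in the range of `r` with the string `y`. -/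
def overwrite {k t n : ℕ} (r : Fin k → Wires t n) (y : Bits k) (x : Basis t n) : Basis t n :=
  Function.extend r y x

/-- The entry oracle on basis states: `z` becomes `z ⊕ A_jk`. -/
def entryAction {n m t : ℕ} (entry : Bits n → Bits n → Bits m)
    (r : (Fin n ⊕ Fin n) ⊕ Fin m → Wires t n) (x : Basis t n) : Basis t n :=
  overwrite (fun i => r (.inr i))
    (fun i => x (r (.inr i)) +
      entry (fun a => x (r (.inl (.inl a)))) (fun a => x (r (.inl (.inr a)))) i) x

/-- The column oracle on basis states: `l` becomes `σ j l`. -/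
def colAction {n t : ℕ} (σ : Bits n → Equiv.Perm (Bits n))
    (r : Fin n ⊕ Fin n → Wires t n) (x : Basis t n) : Basis t n :=
  overwrite (fun i => r (.inr i))
    (σ (fun a => x (r (.inl a))) (fun a => x (r (.inr a)))) x

/-- The linear operator `|x⟩ ↦ |g x⟩`. -/
def basisMatrix {ι : Type} [DecidableEq ι] (g : ι → ι) : Matrix ι ι ℂ :=
  Matrix.of fun y x => if g x = y then 1 else 0

theorem basisMatrix_mem_unitaryGroup {ι : Type} [Fintype ι] [DecidableEq ι] {g : ι → ι}
    (hg : Function.Injective g) : basisMatrix g ∈ Matrix.unitaryGroup ι ℂ := by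
  rw [Matrix.mem_unitaryGroup_iff']
  ext i j
  simp [basisMatrix, Matrix.mul_apply, Matrix.star_apply, Matrix.one_apply, hg.eq_iff, eq_comm]

theorem overwrite_apply {k t n : ℕ} {r : Fin k → Wires t n} (hr : Function.Injective r)
    (y : Bits k) (x : Basis t n) (i : Fin k) : overwrite r y x (r i) = y i :=
  hr.extend_apply y x i

theorem overwrite_apply_of_ne {k t n : ℕ} {r : Fin k → Wires t n}
    (y : Bits k) (x : Basis t n) {q : Wires t n} (hq : ∀ i, r i ≠ q) :
    overwrite r y x q = x q :=
  Function.extend_apply' _ _ _ fun ⟨i, hi⟩ => hq i hi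

theorem entryAction_injective {n m t : ℕ} (entry : Bits n → Bits n → Bits m)
    (r : (Fin n ⊕ Fin n) ⊕ Fin m ↪ Wires t n) :
    Function.Injective (entryAction entry r) := by
  have hz : Function.Injective fun i : Fin m => r (.inr i) :=
    r.injective.comp Sum.inr_injective
  have key : ∀ x, ∀ a, entryAction entry r x (r (.inl a)) = x (r (.inl a)) := fun x a =>
    overwrite_apply_of_ne _ _ fun i h => by simpa using r.injective h
  intro x x' h
  have h1 : ∀ a, x (r (.inl a)) = x' (r (.inl a)) := fun a => by
    rw [← key x a, ← key x' a, h]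
  funext q
  by_cases hq : ∃ i, r (.inr i) = q
  · obtain ⟨i, rfl⟩ := hq
    have h2 := congrFun h (r (.inr i))
    simp only [entryAction] at h2
    rw [overwrite_apply hz _ _ i, overwrite_apply hz _ _ i] at h2
    simpa [h1] using h2
  · have hq' : ∀ i, r (.inr i) ≠ q := fun i hi => hq ⟨i, hi⟩
    have h2 := congrFun h q
    simp only [entryAction] at h2
    rwa [overwrite_apply_of_ne _ _ hq', overwrite_apply_of_ne _ _ hq'] at h2

theorem colAction_injective {n t : ℕ} (σ : Bits n → Equiv.Perm (Bits n))
    (r : Fin n ⊕ Fin n ↪ Wires t n) : Function.Injective (colAction σ r) := by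
  have hz : Function.Injective fun i : Fin n => r (.inr i) :=
    r.injective.comp Sum.inr_injective
  have key : ∀ x, ∀ a, colAction σ r x (r (.inl a)) = x (r (.inl a)) := fun x a =>
    overwrite_apply_of_ne _ _ fun i h => by simpa using r.injective h
  intro x x' h
  have h1 : ∀ a, x (r (.inl a)) = x' (r (.inl a)) := fun a => by
    rw [← key x a, ← key x' a, h]
  have h3 : (fun a => x (r (.inr a))) = fun a => x' (r (.inr a)) := by
    apply (σ (fun a => x (r (.inl a)))).injective
    funext i
    have h2 := congrFun h (r (.inr i))
    simp only [colAction] at h2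
    rw [overwrite_apply hz _ _ i, overwrite_apply hz _ _ i] at h2
    simpa [h1] using h2
  funext q
  by_cases hq : ∃ i, r (.inr i) = q
  · obtain ⟨i, rfl⟩ := hq
    exact congrFun h3 i
  · have hq' : ∀ i, r (.inr i) ≠ q := fun i hi => hq ⟨i, hi⟩
    have h2 := congrFun h q
    simp only [colAction] at h2
    rwa [overwrite_apply_of_ne _ _ hq', overwrite_apply_of_ne _ _ hq'] at h2

/-- The unitary performed by a gate, for given oracles. -/
def Gate.toUnitary {n m t d : ℕ} {val : Bits m → ℂ} {A : Matrix (Bits n) (Bits n) ℂ}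
    (O : SparseOracle d val A) : Gate n m t → Matrix.unitaryGroup (Basis t n) ℂ
  | .free V => V
  | .entryQuery r =>
      ⟨basisMatrix (entryAction O.entry r),
        basisMatrix_mem_unitaryGroup (entryAction_injective O.entry r)⟩
  | .colQuery r inv =>
      ⟨basisMatrix (colAction (fun j => if inv then (O.col j).symm else O.col j) r),
        basisMatrix_mem_unitaryGroup (colAction_injective _ r)⟩

/-- The unitary performed by a circuit; the head of the list is applied first. -/
def circuitUnitary {n m t d : ℕ} {val : Bits m → ℂ} {A : Matrix (Bits n) (Bits n) ℂ}
    (O : SparseOracle d val A) : List (Gate n m t) → Matrix.unitaryGroup (Basis t n) ℂ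
  | [] => 1
  | g :: c => circuitUnitary O c * g.toUnitary O

/-- The state `|0^t⟩|ψ⟩`. -/
def initialState (t : ℕ) {n : ℕ} (ψ : EuclideanSpace ℂ (Bits n)) :
    EuclideanSpace ℂ (Basis t n) :=
  WithLp.toLp 2 fun x => if ∀ i, x (.inl i) = 0 then ψ (fun i => x (.inr i)) else 0

/-- The vector `(⟨b| ⊗ I) U |0^t⟩|ψ⟩`, that is, the unnormalized state of the system qubits after
`U` has been applied to `|0^t⟩|ψ⟩` and the ancilla qubits have been measured with outcome `b`. -/
def branch {t n : ℕ} (U : Matrix.unitaryGroup (Basis t n) ℂ) (b : Bits t)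
    (ψ : EuclideanSpace ℂ (Bits n)) : EuclideanSpace ℂ (Bits n) :=
  WithLp.toLp 2 fun s =>
    Matrix.toEuclideanCLM (𝕜 := ℂ) (U : Matrix (Basis t n) (Basis t n) ℂ) (initialState t ψ)
      (Sum.elim b s)

/-- The probability that the measurement of the ancilla qubits has outcome `b`. The outcome `0^t`
is the flag that signals success. -/
def outcomeProb {t n : ℕ} (U : Matrix.unitaryGroup (Basis t n) ℂ) (b : Bits t)
    (ψ : EuclideanSpace ℂ (Bits n)) : ℝ :=
  ‖branch U b ψ‖ ^ 2

/-- The normalized state of the system qubits after outcome `b`. -/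
def postState {t n : ℕ} (U : Matrix.unitaryGroup (Basis t n) ℂ) (b : Bits t)
    (ψ : EuclideanSpace ℂ (Bits n)) : EuclideanSpace ℂ (Bits n) :=
  ((‖branch U b ψ‖⁻¹ : ℝ) : ℂ) • branch U b ψ

/-- The Maclaurin coefficients `α_i = f^(i)(0) / i!`. -/
def maclaurinCoeff (f : ℝ → ℝ) (i : ℕ) : ℝ := iteratedDeriv i f 0 / (i.factorial : ℝ)

/-- `μ = inf |f|` over `[-1, 1]`. -/
def infAbs (f : ℝ → ℝ) : ℝ := sInf ((fun x => |f x|) '' Set.Icc (-1) 1)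

/-- `γ = ∑_{i ≤ L} d^i |α_i|`. -/
def coeffWeight (f : ℝ → ℝ) (d L : ℕ) : ℝ :=
  ∑ i ∈ Finset.range (L + 1), (d : ℝ) ^ i * |maclaurinCoeff f i|

end

/-!
Let `P` be the Maclaurin polynomial of `f` of degree `L`. By the Lagrange remainder, it is
`δ`-close to `f` on `[-1, 1]` with `δ = C / (L + 1)! ≤ C / 2 ^ L < ε` (`abs_sub_maclaurin_le`), so
that preparing `P(A) ψ / γ` would do for the two approximate assertions. For the bound `(infAbs f
/ γ) ^ 2`, where no error is allowed, `P` is replaced by a polynomial of no larger weight whose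
modulus is at least `infAbs f` everywhere (`exists_corrected_coeff`): if `infAbs f > 0`, then `f`
has constant sign, and a part `min δ R` of the weight `R = ∑_{1 ≤ i ≤ L} d ^ i |α_i|` of the
nonconstant terms is moved to the constant term. All comparisons of vectors are then comparisons
of functions on the spectrum of `A` (`Matrix.IsHermitian.norm_cfc_le`).

A polynomial `∑ b_i A ^ i` with `∑ d ^ i |b_i| ≤ γ` is prepared with subnormalization `γ` and `4
L` queries (`exists_circuit_polynomial`). Starting from a superposition of `D` columns of a row,
the column oracle, a phase that depends on the entry `A j k`, the exchange of row and column, and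
the inverse of the column oracle lead back to the same superposition with amplitude matrix `A / D`
(`workProj_walkMatrix_mulVec`). The modulus of the entry is realized by one further qubit, because
a number of modulus at most one is the average of two phases (`exists_phases`). If the phase and
the exchange are omitted, the oracles cancel out; so a register with the term index `i` controls
how many times `A / D` is applied, although the oracles are not controlled. The measurement after
each step is deferred by writing its failure into a fresh label, which prevents failed components
from interfering later (`recordedProduct_mulVec`). Preparing the term register in a state `v` and
reading it off in a state `u` gives the linear combination with coefficients `u i * v i`
(`exists_circuit_of_unit_vectors`), and each sequence of total weight at most one has this form
(`exists_unit_vectors`).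
-/

open scoped Kronecker

noncomputable section

/-! ### The truncated Maclaurin series and its correction -/

/-- Lagrange form of the remainder; only interior points enter, so that the bound on the derivatives
in the open interval suffices up to the end points. -/
theorem abs_sub_maclaurin_le {f : ℝ → ℝ} {C : ℝ} (hf : ContDiffOn ℝ ∞ f (Set.Icc (-1) 1))
    (hC : ∀ i : ℕ, 1 ≤ i → ∀ x ∈ Set.Ioo (-1 : ℝ) 1, |iteratedDeriv i f x| ≤ C) (hC0 : 0 ≤ C)
    (L : ℕ) {x : ℝ} (hx : x ∈ Set.Icc (-1 : ℝ) 1) :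
    |f x - ∑ i ∈ Finset.range (L + 1), maclaurinCoeff f i * x ^ i| ≤
      C / ((L + 1).factorial : ℝ) := by
  rcases eq_or_ne x 0 with rfl | hx0
  · rw [Finset.sum_range_succ']
    simp only [maclaurinCoeff]
    simp
    positivity
  have hsub : Set.uIcc 0 x ⊆ Set.Icc (-1 : ℝ) 1 :=
    Set.uIcc_subset_Icc (by norm_num) hx
  have hioo : Set.uIoo 0 x ⊆ Set.Ioo (-1 : ℝ) 1 := by
    intro y hy
    simp only [Set.uIoo, Set.mem_Ioo, inf_lt_iff, lt_sup_iff] at hy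
    obtain ⟨h1, h2⟩ := hx
    constructor <;> rcases hy with ⟨h3 | h3, h4 | h4⟩ <;> linarith
  have huniq : UniqueDiffOn ℝ (Set.uIcc 0 x) := uniqueDiffOn_Icc (by simpa using hx0)
  have hat : ∀ y ∈ Set.Ioo (-1 : ℝ) 1, ContDiffAt ℝ ∞ f y := fun y hy =>
    hf.contDiffAt (Icc_mem_nhds hy.1 hy.2)
  have hle : ∀ k : ℕ, (k : WithTop ℕ∞) ≤ ∞ := fun k => by exact_mod_cast le_top
  have hf0 : ∀ k : ℕ, ContDiffOn ℝ k f (Set.uIcc 0 x) := fun k =>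
    (hf.mono hsub).of_le (hle k)
  obtain ⟨y, hy, hxy⟩ := taylor_mean_remainder_lagrange (n := L) hx0.symm (hf0 L) (by
    refine ((hf0 (L + 1)).differentiableOn_iteratedDerivWithin ?_ huniq).mono
      Set.Ioo_subset_Icc_self
    exact_mod_cast Nat.lt_succ_self L)
  have hcoe : taylorWithinEval f L (Set.uIcc 0 x) 0 x =
      ∑ i ∈ Finset.range (L + 1), maclaurinCoeff f i * x ^ i := by
    rw [taylor_within_apply]
    refine Finset.sum_congr rfl fun i _ => ?_
    rw [iteratedDerivWithin_eq_iteratedDeriv huniq ((hat 0 (by simp)).of_le (hle i))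
      Set.left_mem_uIcc]
    simp [maclaurinCoeff]
    ring
  rw [← hcoe, hxy, iteratedDerivWithin_eq_iteratedDeriv huniq
    ((hat y (hioo hy)).of_le (hle _)) (Set.Ioo_subset_Icc_self hy), abs_div, abs_mul, sub_zero,
    Nat.abs_cast]
  gcongr
  calc |iteratedDeriv (L + 1) f y| * |x ^ (L + 1)| ≤ C * 1 := by
        refine mul_le_mul (hC _ (by omega) y (hioo hy)) ?_ (abs_nonneg _) hC0
        rw [abs_pow]
        exact pow_le_one₀ (abs_nonneg _) (abs_le.2 hx)
    _ = C := mul_one C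

theorem infAbs_le {f : ℝ → ℝ} {x : ℝ} (hx : x ∈ Set.Icc (-1 : ℝ) 1) : infAbs f ≤ |f x| :=
  csInf_le ⟨0, by rintro _ ⟨y, -, rfl⟩; exact abs_nonneg _⟩ ⟨x, hx, rfl⟩

/-- If the constant coefficient is at least `μ > 0`, a part `min δ R` of the weight `R` of the
nonconstant terms can be moved to the constant term: the total weight is unchanged, and the constant
term then makes up for the truncation error `δ`. -/
theorem exists_corrected_coeff_of_pos {f : ℝ → ℝ} {α : ℕ → ℝ} {d L : ℕ} {δ μ : ℝ} (hδ : 0 ≤ δ)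
    (hμ : 0 < μ) (hf : ∀ x ∈ Set.Icc (-1 : ℝ) 1, μ ≤ f x) (hα : μ ≤ α 0)
    (hT : ∀ x ∈ Set.Icc (-1 : ℝ) 1, |f x - ∑ i ∈ Finset.range (L + 1), α i * x ^ i| ≤ δ) :
    ∃ b : ℕ → ℝ,
      ∑ i ∈ Finset.range (L + 1), (d : ℝ) ^ i * |b i| ≤
        ∑ i ∈ Finset.range (L + 1), (d : ℝ) ^ i * |α i| ∧
      ∀ x ∈ Set.Icc (-1 : ℝ) 1, |x| ≤ d →
        μ ≤ |∑ i ∈ Finset.range (L + 1), b i * x ^ i| ∧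
        |f x| ≤ |∑ i ∈ Finset.range (L + 1), b i * x ^ i| + δ ∧
        |(∑ i ∈ Finset.range (L + 1), b i * x ^ i) - f x| ≤ 3 * δ := by
  set R : ℝ := ∑ i ∈ Finset.range L, (d : ℝ) ^ (i + 1) * |α (i + 1)| with hR
  have hR0 : 0 ≤ R := Finset.sum_nonneg fun i _ => by positivity
  obtain ⟨s, hs0, hs1, hsR⟩ : ∃ s : ℝ, 0 ≤ s ∧ s ≤ 1 ∧ (1 - s) * R = min δ R := by
    rcases hR0.eq_or_lt with h | h
    · exact ⟨1, zero_le_one, le_rfl, by rw [← h]; simp [hδ]⟩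
    · refine ⟨1 - min δ R / R, ?_, ?_, by field_simp; ring⟩
      · rw [sub_nonneg, div_le_one h]
        exact min_le_right _ _
      · have : 0 ≤ min δ R / R := div_nonneg (le_min hδ hR0) hR0
        linarith
  set τ := min δ R with hτ
  have hτ0 : 0 ≤ τ := le_min hδ hR0
  have hτδ : τ ≤ δ := min_le_left _ _
  have hα0 : 0 < α 0 := hμ.trans_le hα
  refine ⟨fun i => if i = 0 then α 0 + τ else s * α i, ?_, fun x hx hxd => ?_⟩
  · rw [Finset.sum_range_succ', Finset.sum_range_succ']
    have : ∑ i ∈ Finset.range L, (d : ℝ) ^ (i + 1) *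
        |if i + 1 = 0 then α 0 + τ else s * α (i + 1)| = s * R := by
      rw [hR, Finset.mul_sum]
      refine Finset.sum_congr rfl fun i _ => ?_
      rw [if_neg (Nat.succ_ne_zero i), abs_mul, abs_of_nonneg hs0]
      ring
    rw [this, ← hR]
    simp only [if_pos, pow_zero, one_mul]
    rw [abs_of_pos hα0, abs_of_pos (by linarith)]
    linarith
  · have hTx := hT x hx
    have hfx := hf x hx
    rw [Finset.sum_range_succ'] at hTx
    rw [Finset.sum_range_succ']
    set p := ∑ i ∈ Finset.range L, α (i + 1) * x ^ (i + 1) with hp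
    have hb : ∑ i ∈ Finset.range L, (if i + 1 = 0 then α 0 + τ else s * α (i + 1)) * x ^ (i + 1)
        = s * p := by
      rw [hp, Finset.mul_sum]
      refine Finset.sum_congr rfl fun i _ => ?_
      rw [if_neg (Nat.succ_ne_zero i)]
      ring
    have hpR : |p| ≤ R := by
      refine (Finset.abs_sum_le_sum_abs _ _).trans (Finset.sum_le_sum fun i _ => ?_)
      rw [abs_mul, abs_pow, mul_comm]
      gcongr
    rw [hb]
    simp only [if_pos, pow_zero, mul_one] at hTx ⊢
    rw [abs_le] at hTx hpR
    have h1 : (1 - s) * p ≤ τ := by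
      rw [← hsR]
      exact mul_le_mul_of_nonneg_left hpR.2 (by linarith)
    have h2 : -τ ≤ (1 - s) * p := by
      have := mul_le_mul_of_nonneg_left hpR.1 (by linarith : 0 ≤ 1 - s)
      linarith
    have hg : μ ≤ s * p + (α 0 + τ) := by
      rcases le_total δ R with h | h
      · -- a convex combination of `p + α 0 + δ ≥ f x` and `α 0 + δ`
        have e : τ = δ := min_eq_left h
        have h3 : s * μ ≤ s * (p + α 0 + δ) := mul_le_mul_of_nonneg_left (by linarith) hs0
        have h4 : (1 - s) * μ ≤ (1 - s) * (α 0 + δ) :=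
          mul_le_mul_of_nonneg_left (by linarith) (by linarith)
        rw [e]
        nlinarith
      · have e : τ = R := min_eq_right h
        have h3 : s * (-R) ≤ s * p := mul_le_mul_of_nonneg_left hpR.1 hs0
        have h4 : s * R ≤ 1 * R := mul_le_mul_of_nonneg_right hs1 hR0
        linarith
    rw [abs_of_pos (hμ.trans_le hfx), abs_of_pos (hμ.trans_le hg)]
    refine ⟨hg, by linarith, ?_⟩
    rw [abs_le]
    constructor <;> linarith

/-- Without increasing the weight `∑ dⁱ |αᵢ|`, a polynomial that is `δ`-close to `f` can be replaced
by one that respects the lower bound `infAbs f` exactly. If `infAbs f` is positive, then `f` has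
constant sign, and the sign tells in which direction to correct. -/
theorem exists_corrected_coeff {f : ℝ → ℝ} {α : ℕ → ℝ} {d L : ℕ} {δ : ℝ} (hδ : 0 ≤ δ)
    (hf : ContinuousOn f (Set.Icc (-1) 1)) (hα : α 0 = f 0)
    (hT : ∀ x ∈ Set.Icc (-1 : ℝ) 1, |f x - ∑ i ∈ Finset.range (L + 1), α i * x ^ i| ≤ δ) :
    ∃ b : ℕ → ℝ,
      ∑ i ∈ Finset.range (L + 1), (d : ℝ) ^ i * |b i| ≤
        ∑ i ∈ Finset.range (L + 1), (d : ℝ) ^ i * |α i| ∧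
      ∀ x ∈ Set.Icc (-1 : ℝ) 1, |x| ≤ d →
        infAbs f ≤ |∑ i ∈ Finset.range (L + 1), b i * x ^ i| ∧
        |f x| ≤ |∑ i ∈ Finset.range (L + 1), b i * x ^ i| + δ ∧
        |(∑ i ∈ Finset.range (L + 1), b i * x ^ i) - f x| ≤ 3 * δ := by
  have h0 : (0 : ℝ) ∈ Set.Icc (-1 : ℝ) 1 := by simp
  rcases le_or_gt (infAbs f) 0 with hμ | hμ
  · refine ⟨α, le_rfl, fun x hx _ => ⟨hμ.trans (abs_nonneg _), ?_, ?_⟩⟩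
    · linarith [hT x hx, abs_sub_abs_le_abs_sub (f x) (∑ i ∈ Finset.range (L + 1), α i * x ^ i)]
    · rw [abs_sub_comm]
      linarith [hT x hx]
  have hne : ∀ x ∈ Set.Icc (-1 : ℝ) 1, f x ≠ 0 := fun x hx h => by
    have := infAbs_le (f := f) hx
    rw [h, abs_zero] at this
    linarith
  have hsign : (∀ x ∈ Set.Icc (-1 : ℝ) 1, 0 < f x) ∨ ∀ x ∈ Set.Icc (-1 : ℝ) 1, f x < 0 := by
    by_contra! h
    obtain ⟨⟨x, hx, hfx⟩, y, hy, hfy⟩ := h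
    obtain ⟨z, hz, hfz⟩ := isPreconnected_Icc.intermediate_value hx hy hf ⟨hfx, hfy⟩
    exact hne z hz hfz
  rcases hsign with h | h
  · have hf' : ∀ x ∈ Set.Icc (-1 : ℝ) 1, infAbs f ≤ f x := fun x hx => by
      simpa [abs_of_pos (h x hx)] using infAbs_le (f := f) hx
    exact exists_corrected_coeff_of_pos hδ hμ hf' (hα ▸ hf' 0 h0) hT
  · have hf' : ∀ x ∈ Set.Icc (-1 : ℝ) 1, infAbs f ≤ -f x := fun x hx => by
      simpa [abs_of_neg (h x hx)] using infAbs_le (f := f) hx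
    obtain ⟨b, hb, hb'⟩ := exists_corrected_coeff_of_pos (f := fun x => -f x)
      (α := fun i => -α i) (d := d) (L := L) hδ hμ hf' (by simpa [hα] using hf' 0 h0)
      (fun x hx => by
        have := hT x hx
        rw [← abs_neg] at this
        convert this using 2
        simp only [neg_mul, Finset.sum_neg_distrib]
        ring)
    refine ⟨fun i => -b i, by simpa using hb, fun x hx hxd => ?_⟩
    have := hb' x hx hxd
    simp only [neg_mul, Finset.sum_neg_distrib, abs_neg] at this ⊢
    refine ⟨this.1, this.2.1, ?_⟩
    rw [← abs_neg]
    convert this.2.2 using 2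
    ring

/-! ### Functions of a Hermitian matrix -/

section Hermitian

variable {ι : Type} [Fintype ι] [DecidableEq ι] {A : Matrix ι ι ℂ}

theorem Matrix.IsHermitian.cfc_eq_mul (hA : A.IsHermitian) (g : ℝ → ℝ) :
    hA.cfc g = (hA.eigenvectorUnitary : Matrix ι ι ℂ) *
      Matrix.diagonal (RCLike.ofReal ∘ g ∘ hA.eigenvalues) *
      star (hA.eigenvectorUnitary : Matrix ι ι ℂ) := by
  rw [Matrix.IsHermitian.cfc, Unitary.conjStarAlgAut_apply]

theorem Matrix.IsHermitian.cfc_sub' (hA : A.IsHermitian) (g h : ℝ → ℝ) :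
    hA.cfc (fun x => g x - h x) = hA.cfc g - hA.cfc h := by
  rw [Matrix.IsHermitian.cfc, Matrix.IsHermitian.cfc, Matrix.IsHermitian.cfc, ← map_sub,
    Matrix.diagonal_sub]
  congr 2
  ext i
  simp

theorem Matrix.IsHermitian.cfc_const' (hA : A.IsHermitian) (r : ℝ) :
    hA.cfc (fun _ => r) = (r : ℂ) • 1 := by
  rw [Matrix.IsHermitian.cfc,
    show Matrix.diagonal (RCLike.ofReal ∘ (fun _ => r) ∘ hA.eigenvalues) =
      (r : ℂ) • (1 : Matrix ι ι ℂ) by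
        rw [Matrix.smul_one_eq_diagonal]
        congr 1,
    map_smul, map_one]

theorem Matrix.IsHermitian.cfc_polynomial (hA : A.IsHermitian) (b : ℕ → ℝ) (L : ℕ) :
    hA.cfc (fun x => ∑ i ∈ Finset.range L, b i * x ^ i) =
      ∑ i ∈ Finset.range L, (b i : ℂ) • A ^ i := by
  conv_rhs => rw [hA.spectral_theorem]
  simp only [← map_pow, ← map_smul, ← map_sum]
  rw [Matrix.IsHermitian.cfc]
  congr 1
  ext i j
  by_cases h : i = j
  · subst h
    simp [Matrix.sum_apply, Matrix.diagonal_pow]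
  · simp [Matrix.sum_apply, Matrix.diagonal_pow, h]

theorem Matrix.norm_toEuclideanCLM_of_mem_unitaryGroup {U : Matrix ι ι ℂ}
    (hU : U ∈ Matrix.unitaryGroup ι ℂ) (v : EuclideanSpace ℂ ι) :
    ‖Matrix.toEuclideanCLM (𝕜 := ℂ) U v‖ = ‖v‖ := by
  have : Matrix.toEuclideanCLM (𝕜 := ℂ) U ∈ unitary _ := Unitary.map_mem _ hU
  exact ContinuousLinearMap.norm_map_of_mem_unitary this v

/-- `‖g(A) v‖` depends monotonically on `|g|` on the spectrum. -/
theorem Matrix.IsHermitian.norm_cfc_le (hA : A.IsHermitian) {g h : ℝ → ℝ}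
    (hgh : ∀ i, |g (hA.eigenvalues i)| ≤ |h (hA.eigenvalues i)|) (v : EuclideanSpace ℂ ι) :
    ‖Matrix.toEuclideanCLM (𝕜 := ℂ) (hA.cfc g) v‖ ≤
      ‖Matrix.toEuclideanCLM (𝕜 := ℂ) (hA.cfc h) v‖ := by
  rw [hA.cfc_eq_mul, hA.cfc_eq_mul, map_mul, map_mul, map_mul, map_mul]
  simp only [mul_apply_eq_comp]
  rw [Matrix.norm_toEuclideanCLM_of_mem_unitaryGroup hA.eigenvectorUnitary.2,
    Matrix.norm_toEuclideanCLM_of_mem_unitaryGroup hA.eigenvectorUnitary.2]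
  rw [EuclideanSpace.norm_eq, EuclideanSpace.norm_eq]
  refine Real.sqrt_le_sqrt (Finset.sum_le_sum fun i _ => ?_)
  simp only [Matrix.ofLp_toEuclideanCLM, Matrix.mulVec_diagonal, norm_mul, mul_pow]
  gcongr
  simpa using hgh i

theorem Matrix.IsHermitian.abs_eigenvalues_le (hA : A.IsHermitian) {r : ℝ}
    (h : ‖Matrix.toEuclideanCLM (𝕜 := ℂ) A‖ ≤ r) (i : ι) : |hA.eigenvalues i| ≤ r := by
  have h1 := (Matrix.toEuclideanCLM (𝕜 := ℂ) A).le_of_opNorm_le h (hA.eigenvectorBasis i)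
  have h2 : Matrix.toEuclideanCLM (𝕜 := ℂ) A (hA.eigenvectorBasis i) =
      (hA.eigenvalues i : ℂ) • hA.eigenvectorBasis i := by
    apply WithLp.ofLp_injective
    rw [Matrix.ofLp_toEuclideanCLM, hA.mulVec_eigenvectorBasis]
    rfl
  rw [h2, norm_smul] at h1
  simpa using h1

theorem Matrix.norm_apply_le_norm_toEuclideanCLM (A : Matrix ι ι ℂ) (i j : ι) :
    ‖A i j‖ ≤ ‖Matrix.toEuclideanCLM (𝕜 := ℂ) A‖ := by
  have h1 := (Matrix.toEuclideanCLM (𝕜 := ℂ) A).le_opNorm (EuclideanSpace.single j 1)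
  have h2 := PiLp.norm_apply_le (Matrix.toEuclideanCLM (𝕜 := ℂ) A (EuclideanSpace.single j 1)) i
  rw [Matrix.ofLp_toEuclideanCLM] at h2
  simpa using h2.trans h1

end Hermitian

/-- Normalization is Lipschitz away from zero; the inequality persists for `u = 0`, when the left
hand side has norm at most one. -/
theorem norm_normalize_sub_le {E : Type*} [NormedAddCommGroup E] [NormedSpace ℂ E] (u w : E)
    (hw : w ≠ 0) :
    ‖((‖u‖⁻¹ : ℝ) : ℂ) • u - ((‖w‖⁻¹ : ℝ) : ℂ) • w‖ ≤ 2 * ‖u - w‖ / ‖w‖ := by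
  have hw' : 0 < ‖w‖ := norm_pos_iff.2 hw
  have key : ‖w‖ * ‖((‖u‖⁻¹ : ℝ) : ℂ) • u - ((‖w‖⁻¹ : ℝ) : ℂ) • w‖ ≤ 2 * ‖u - w‖ := by
    have e : (‖w‖ : ℂ) • (((‖u‖⁻¹ : ℝ) : ℂ) • u - ((‖w‖⁻¹ : ℝ) : ℂ) • w) =
        (((‖w‖ - ‖u‖) * ‖u‖⁻¹ : ℝ) : ℂ) • u + (u - w) := by
      rcases eq_or_ne u 0 with rfl | hu
      · rw [smul_sub, smul_smul, smul_smul, ← Complex.ofReal_mul, ← Complex.ofReal_mul,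
          mul_inv_cancel₀ hw'.ne']
        simp
      · have hu' : ‖u‖ ≠ 0 := norm_ne_zero_iff.2 hu
        rw [smul_sub, smul_smul, smul_smul, ← Complex.ofReal_mul, ← Complex.ofReal_mul,
          mul_inv_cancel₀ hw'.ne', sub_mul, mul_inv_cancel₀ hu']
        push_cast
        module
    calc _ = ‖(‖w‖ : ℂ) • (((‖u‖⁻¹ : ℝ) : ℂ) • u - ((‖w‖⁻¹ : ℝ) : ℂ) • w)‖ := by
          rw [norm_smul (‖w‖ : ℂ)]
          simp
      _ ≤ ‖(((‖w‖ - ‖u‖) * ‖u‖⁻¹ : ℝ) : ℂ) • u‖ + ‖u - w‖ := by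
          rw [e]
          exact norm_add_le _ _
      _ ≤ ‖u - w‖ + ‖u - w‖ := by
          gcongr
          rw [norm_smul, Complex.norm_real, norm_mul, norm_inv, norm_norm, mul_assoc]
          calc _ ≤ ‖‖w‖ - ‖u‖‖ * 1 := by
                gcongr
                exact inv_mul_le_one
            _ ≤ ‖u - w‖ := by
                rw [mul_one, norm_sub_rev u w]
                exact abs_norm_sub_norm_le w u
      _ = 2 * ‖u - w‖ := by ring
  rw [le_div_iff₀ hw']
  linarith

/-! ### Unitary matrices -/

/-- A number of modulus at most one is the average of two phases. -/
theorem exists_phases (v : ℂ) :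
    ∃ φ : Fin 2 → ℂ, (∀ b, star (φ b) * φ b = 1) ∧ (‖v‖ ≤ 1 → φ 0 + φ 1 = 2 * v) := by
  by_cases hv : ‖v‖ ≤ 1
  · have hexp : ∀ θ : ℝ, star (Complex.exp (θ * Complex.I)) * Complex.exp (θ * Complex.I) = 1 := by
      intro θ
      rw [Complex.star_def, ← Complex.normSq_eq_conj_mul_self, Complex.normSq_eq_norm_sq,
        Complex.norm_exp_ofReal_mul_I]
      simp
    refine ⟨![Complex.exp ((v.arg + Real.arccos ‖v‖ : ℝ) * Complex.I),
      Complex.exp ((v.arg - Real.arccos ‖v‖ : ℝ) * Complex.I)], ?_, fun _ => ?_⟩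
    · intro b
      fin_cases b
      · exact hexp _
      · exact hexp _
    · have hc : Complex.exp ((Real.arccos ‖v‖ : ℝ) * Complex.I) +
          Complex.exp (-((Real.arccos ‖v‖ : ℝ) * Complex.I)) = 2 * (‖v‖ : ℂ) := by
        rw [← neg_mul, ← Complex.two_cos, ← Complex.ofReal_cos, Real.cos_arccos
          (by linarith [norm_nonneg v]) hv]
      simp only [Matrix.cons_val_zero, Matrix.cons_val_one]
      push_cast
      rw [add_mul, sub_mul, sub_eq_add_neg, Complex.exp_add, Complex.exp_add, ← mul_add, hc]
      conv_rhs => rw [← Complex.norm_mul_exp_arg_mul_I v]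
      ring
  · exact ⟨fun _ => 1, by simp, fun h => absurd h hv⟩

/-- Every isometry extends to a unitary: columns of a unitary matrix may be prescribed as long as
they are orthonormal. -/
theorem exists_unitary_apply_eq {X T : Type} [Fintype X] [DecidableEq X] [Fintype T] [DecidableEq T]
    {κ : T → X} (hκ : Function.Injective κ) {V : Matrix X T ℂ} (hV : V.conjTranspose * V = 1) :
    ∃ U ∈ Matrix.unitaryGroup X ℂ, ∀ x t, U x (κ t) = V x t := by
  let v : X → EuclideanSpace ℂ X := Function.extend κ (fun t => WithLp.toLp 2 fun x => V x t) 0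
  have hv : ∀ t, v (κ t) = WithLp.toLp 2 fun x => V x t := fun t => hκ.extend_apply _ _ t
  have ho : Orthonormal ℂ ((Set.range κ).domRestrict v) := by
    rw [orthonormal_iff_ite]
    rintro ⟨_, t, rfl⟩ ⟨_, t', rfl⟩
    have := congrFun (congrFun hV t) t'
    simp only [Matrix.mul_apply, Matrix.conjTranspose_apply, Matrix.one_apply] at this
    simp only [Set.domRestrict_apply, hv, PiLp.inner_apply, RCLike.inner_apply]
    have hif : (if (⟨κ t, t, rfl⟩ : Set.range κ) = ⟨κ t', t', rfl⟩ then (1 : ℂ) else 0) =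
        if t = t' then 1 else 0 :=
      if_congr (Subtype.ext_iff.trans hκ.eq_iff) rfl rfl
    refine Eq.trans ?_ (this.trans hif.symm)
    refine Finset.sum_congr rfl fun x _ => ?_
    rw [mul_comm]
    rfl
  obtain ⟨b, hb⟩ := ho.exists_orthonormalBasis_extension_of_card_eq (by simp)
  refine ⟨_, (EuclideanSpace.basisFun X ℂ).toMatrix_orthonormalBasis_mem_unitary b,
    fun x t => ?_⟩
  rw [Module.Basis.toMatrix_apply, hb (κ t) ⟨t, rfl⟩, hv]
  simp

section

variable {ι κ : Type} [Fintype ι] [DecidableEq ι] [Fintype κ] [DecidableEq κ]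

theorem basisMatrix_mulVec (e : ι ≃ ι) (w : ι → ℂ) (x : ι) :
    (basisMatrix e).mulVec w x = w (e.symm x) := by
  simp [Matrix.mulVec, dotProduct, basisMatrix, ← Equiv.eq_symm_apply]

theorem basisMatrix_equiv_mem (e : ι ≃ ι) : basisMatrix e ∈ Matrix.unitaryGroup ι ℂ :=
  basisMatrix_mem_unitaryGroup e.injective

omit [Fintype ι] [Fintype κ] in
theorem basisMatrix_kronecker_one (e : ι ≃ ι) :
    basisMatrix e ⊗ₖ (1 : Matrix κ κ ℂ) = basisMatrix (e.prodCongr (Equiv.refl κ)) := by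
  ext ⟨x, f⟩ ⟨y, g⟩
  simp [basisMatrix, Matrix.one_apply, Prod.ext_iff, ite_and, eq_comm]
  split_ifs <;> rfl

omit [DecidableEq ι] in
theorem kronecker_mulVec_apply (M : Matrix ι ι ℂ) (e : κ ≃ κ) (w : ι × κ → ℂ) (x : ι) (f : κ) :
    (M ⊗ₖ basisMatrix e).mulVec w (x, f) = M.mulVec (fun y => w (y, e.symm f)) x := by
  simp [Matrix.mulVec, dotProduct, Fintype.sum_prod_type, basisMatrix, ← Equiv.eq_symm_apply]

omit [DecidableEq ι] in
theorem kronecker_one_mulVec_apply (M : Matrix ι ι ℂ) (w : ι × κ → ℂ) (x : ι) (f : κ) :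
    (M ⊗ₖ (1 : Matrix κ κ ℂ)).mulVec w (x, f) = M.mulVec (fun y => w (y, f)) x := by
  have h := kronecker_mulVec_apply M (Equiv.refl κ) w x f
  have e : basisMatrix (Equiv.refl κ) = 1 := by
    ext x y
    simp [basisMatrix, Matrix.one_apply, eq_comm]
  rwa [e] at h

theorem kronecker_one_mem {M : Matrix ι ι ℂ} (hM : M ∈ Matrix.unitaryGroup ι ℂ) :
    M ⊗ₖ (1 : Matrix κ κ ℂ) ∈ Matrix.unitaryGroup (ι × κ) ℂ :=
  Matrix.kronecker_mem_unitary hM (one_mem _)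

theorem diagonal_mem_unitaryGroup {v : ι → ℂ} (hv : ∀ x, star (v x) * v x = 1) :
    Matrix.diagonal v ∈ Matrix.unitaryGroup ι ℂ := by
  rw [Matrix.mem_unitaryGroup_iff', Matrix.star_eq_conjTranspose, Matrix.diagonal_conjTranspose,
    Matrix.diagonal_mul_diagonal, ← Matrix.diagonal_one]
  congr 1
  funext x
  exact hv x

/-! ### Deferred measurements -/

/-- The coherent version of a two-outcome measurement given by a projection `P`: the label `f` of
the second register is kept on the range of `P`, and `f₀`, `f₁` are exchanged on its complement. -/
def recordMatrix (P : Matrix ι ι ℂ) (f₀ f₁ : κ) : Matrix (ι × κ) (ι × κ) ℂ :=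
  P ⊗ₖ 1 + (1 - P) ⊗ₖ basisMatrix (Equiv.swap f₀ f₁)

theorem recordMatrix_mem {P : Matrix ι ι ℂ} (hP : P.conjTranspose = P) (hPP : P * P = P)
    (f₀ f₁ : κ) : recordMatrix P f₀ f₁ ∈ Matrix.unitaryGroup (ι × κ) ℂ := by
  have hW : basisMatrix (Equiv.swap f₀ f₁) * basisMatrix (Equiv.swap f₀ f₁) = 1 := by
    refine Matrix.ext_of_mulVec_single fun i => ?_
    funext x
    rw [← Matrix.mulVec_mulVec, basisMatrix_mulVec, basisMatrix_mulVec, Matrix.one_mulVec]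
    simp
  have hWs : (basisMatrix (Equiv.swap f₀ f₁)).conjTranspose = basisMatrix (Equiv.swap f₀ f₁) := by
    ext x y
    have h : Equiv.swap f₀ f₁ y = x ↔ Equiv.swap f₀ f₁ x = y := by
      rw [← Equiv.eq_symm_apply, Equiv.symm_swap, eq_comm]
    simp [basisMatrix, h]
  have h1 : (1 - P) * (1 - P) = 1 - P := by
    simp [mul_sub, sub_mul, hPP]
  rw [Matrix.mem_unitaryGroup_iff', Matrix.star_eq_conjTranspose, recordMatrix,
    Matrix.conjTranspose_add, Matrix.conjTranspose_kronecker, Matrix.conjTranspose_kronecker, hWs,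
    Matrix.conjTranspose_sub, hP, Matrix.conjTranspose_one, Matrix.conjTranspose_one, add_mul,
    mul_add, mul_add]
  simp only [← Matrix.mul_kronecker_mul, hPP, h1, hW, one_mul, mul_one]
  simp [mul_sub, sub_mul, hPP, ← Matrix.add_kronecker]

theorem recordMatrix_mulVec_apply (P : Matrix ι ι ℂ) (f₀ f₁ : κ) (w : ι × κ → ℂ) (x : ι) (f : κ) :
    (recordMatrix P f₀ f₁).mulVec w (x, f) = P.mulVec (fun y => w (y, f)) x +
      (1 - P).mulVec (fun y => w (y, Equiv.swap f₀ f₁ f)) x := by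
  rw [recordMatrix, Matrix.add_mulVec, Pi.add_apply, kronecker_one_mulVec_apply,
    kronecker_mulVec_apply, Equiv.symm_swap]

/-- The product of `k` steps: apply `N j` to the first register, then measure `P`, recording a
failure under the label `e (j + 1)`. -/
def recordedProduct (P : Matrix ι ι ℂ) (N : ℕ → Matrix ι ι ℂ) (e : ℕ → κ) :
    ℕ → Matrix (ι × κ) (ι × κ) ℂ
  | 0 => 1
  | k + 1 => recordMatrix P (e 0) (e (k + 1)) * (N k ⊗ₖ 1) * recordedProduct P N e k

/-- The component in which all measurements succeeded. -/
def projectedProduct (P : Matrix ι ι ℂ) (N : ℕ → Matrix ι ι ℂ) : ℕ → Matrix ι ι ℂ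
  | 0 => 1
  | k + 1 => P * N k * projectedProduct P N k

/-- As each failure goes to a fresh label, which is never touched again, failed components do not
return to the label `e 0`. -/
theorem recordedProduct_mulVec (P : Matrix ι ι ℂ) (N : ℕ → Matrix ι ι ℂ) {e : ℕ → κ} {L : ℕ}
    (he : Set.InjOn e (Set.Iic L)) {w : ι × κ → ℂ} (hw : ∀ x, ∀ f, f ≠ e 0 → w (x, f) = 0)
    (k : ℕ) (hk : k ≤ L) :
    (∀ x, (recordedProduct P N e k).mulVec w (x, e 0) =
      (projectedProduct P N k).mulVec (fun y => w (y, e 0)) x) ∧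
    ∀ j, k < j → j ≤ L → ∀ x, (recordedProduct P N e k).mulVec w (x, e j) = 0 := by
  induction k with
  | zero =>
    refine ⟨fun x => by simp [recordedProduct, projectedProduct], fun j hj hjL x => ?_⟩
    rw [recordedProduct, Matrix.one_mulVec]
    exact hw x _ fun h => hj.ne' (he hjL (Nat.zero_le L) h)
  | succ k ih =>
    obtain ⟨ih1, ih2⟩ := ih (by omega)
    have hfun : ∀ j, k < j → j ≤ L →
        (fun y => (recordedProduct P N e k).mulVec w (y, e j)) = 0 := fun j h h' => by
      funext x
      exact ih2 j h h' x
    have hN : ∀ f, (fun y => (N k ⊗ₖ (1 : Matrix κ κ ℂ)).mulVec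
        ((recordedProduct P N e k).mulVec w) (y, f)) =
        (N k).mulVec fun y => (recordedProduct P N e k).mulVec w (y, f) := fun f => by
      funext x
      rw [kronecker_one_mulVec_apply]
    constructor
    · intro x
      rw [recordedProduct, ← Matrix.mulVec_mulVec, ← Matrix.mulVec_mulVec,
        recordMatrix_mulVec_apply, Equiv.swap_apply_left, hN, hN, hfun (k + 1) (by omega) hk,
        Matrix.mulVec_zero, Matrix.mulVec_zero, Pi.zero_apply, add_zero, projectedProduct,
        ← Matrix.mulVec_mulVec, ← Matrix.mulVec_mulVec]
      congr 3
      funext y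
      exact ih1 y
    · intro j hj hjL x
      have h0 : e j ≠ e 0 := fun h => by
        have : j = 0 := he hjL (Nat.zero_le L) h
        omega
      have h1 : e j ≠ e (k + 1) := fun h => hj.ne' (he hjL hk h)
      rw [recordedProduct, ← Matrix.mulVec_mulVec, ← Matrix.mulVec_mulVec,
        recordMatrix_mulVec_apply, Equiv.swap_apply_of_ne_of_ne h0 h1, hN,
        hfun j (by omega) hjL]
      simp

end

/-! ### Registers and gates -/

section Registers

variable {n m q : ℕ}

/-- The registers of a circuit: the `n` system qubits come last, the ancilla qubits are divided into
a second `n`-qubit register, an `m`-qubit register for entries, and `q` further qubits. -/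
def registerEquiv (n m q : ℕ) :
    Basis (n + (m + q)) n ≃ Bits n × Bits n × Bits m × Bits q where
  toFun x := (fun i => x (.inr i), fun i => x (.inl (Fin.castAdd _ i)),
    fun i => x (.inl (Fin.natAdd n (Fin.castAdd q i))),
    fun i => x (.inl (Fin.natAdd n (Fin.natAdd m i))))
  invFun p := Sum.elim (Fin.append p.2.1 (Fin.append p.2.2.1 p.2.2.2)) p.1
  left_inv x := by
    funext w
    rcases w with w | w
    · refine Fin.addCases (fun i => ?_) (fun i => ?_) w
      · simp
      · refine Fin.addCases (fun j => ?_) (fun j => ?_) i <;> simp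
    · rfl
  right_inv p := by
    obtain ⟨s, a, z, p⟩ := p
    simp

/-- The wires for a column query: the row index is in the system register. -/
def colWires (n m q : ℕ) : Fin n ⊕ Fin n ↪ Wires (n + (m + q)) n where
  toFun := Sum.elim .inr fun i => .inl (Fin.castAdd _ i)
  inj' := by
    rintro (i | i) (j | j) h <;> simp_all

/-- The wires for an entry query: the column index is in the system register. -/
def entryWires (n m q : ℕ) : (Fin n ⊕ Fin n) ⊕ Fin m ↪ Wires (n + (m + q)) n where
  toFun := Sum.elim (Sum.elim (fun i => .inl (Fin.castAdd _ i)) .inr)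
    fun i => .inl (Fin.natAdd n (Fin.castAdd q i))
  inj' := by
    rintro ((i | i) | i) ((j | j) | j) h <;> simp_all [Fin.ext_iff] <;> omega

theorem castAdd_ne_natAdd {k l : ℕ} (i : Fin k) (j : Fin l) : Fin.castAdd l i ≠ Fin.natAdd k j := by
  intro h
  have := congrArg Fin.val h
  simp at this
  omega

theorem overwrite_inr_of_ne {k l t : ℕ} {α : Type} {r : α ⊕ Fin k → Wires t l} (y : Bits k)
    (x : Basis t l) {w : Wires t l} (hw : ∀ i, r (.inr i) ≠ w) :
    overwrite (fun i => r (.inr i)) y x w = x w :=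
  overwrite_apply_of_ne _ _ hw

theorem registerEquiv_colAction (σ : Bits n → Equiv.Perm (Bits n)) (x : Basis (n + (m + q)) n) :
    registerEquiv n m q (colAction σ (colWires n m q) x) =
      ((registerEquiv n m q x).1,
        σ (registerEquiv n m q x).1 (registerEquiv n m q x).2.1, (registerEquiv n m q x).2.2) := by
  have hinj : Function.Injective fun i => colWires n m q (.inr i) :=
    (colWires n m q).injective.comp Sum.inr_injective
  have h1 : ∀ i, colAction σ (colWires n m q) x (.inr i) = x (.inr i) := fun i =>
    overwrite_inr_of_ne _ _ fun j => Sum.inl_ne_inr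
  have h2 : ∀ i, colAction σ (colWires n m q) x (.inl (Fin.natAdd n i)) =
      x (.inl (Fin.natAdd n i)) := fun i =>
    overwrite_inr_of_ne _ _ fun j h => castAdd_ne_natAdd j i (Sum.inl_injective h)
  have h3 : ∀ i, colAction σ (colWires n m q) x (.inl (Fin.castAdd _ i)) = _ :=
    fun i => overwrite_apply hinj _ _ i
  refine Prod.ext ?_ (Prod.ext ?_ (Prod.ext ?_ ?_)) <;> funext i
  · exact h1 i
  · exact h3 i
  · exact h2 _
  · exact h2 _

theorem registerEquiv_entryAction (entry : Bits n → Bits n → Bits m)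
    (x : Basis (n + (m + q)) n) :
    registerEquiv n m q (entryAction entry (entryWires n m q) x) =
      ((registerEquiv n m q x).1, (registerEquiv n m q x).2.1,
        (registerEquiv n m q x).2.2.1 +
          entry (registerEquiv n m q x).2.1 (registerEquiv n m q x).1,
        (registerEquiv n m q x).2.2.2) := by
  have hinj : Function.Injective fun i => entryWires n m q (.inr i) :=
    (entryWires n m q).injective.comp Sum.inr_injective
  have h1 : ∀ i, entryAction entry (entryWires n m q) x (.inr i) = x (.inr i) := fun i =>
    overwrite_inr_of_ne _ _ fun j => Sum.inl_ne_inr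
  have h2 : ∀ i, entryAction entry (entryWires n m q) x (.inl (Fin.castAdd _ i)) =
      x (.inl (Fin.castAdd _ i)) := fun i =>
    overwrite_inr_of_ne _ _ fun j h => castAdd_ne_natAdd i _ (Sum.inl_injective h).symm
  have h3 : ∀ i, entryAction entry (entryWires n m q) x (.inl (Fin.natAdd n (Fin.natAdd m i))) =
      x (.inl (Fin.natAdd n (Fin.natAdd m i))) := fun i =>
    overwrite_inr_of_ne _ _ fun j h =>
      castAdd_ne_natAdd j i (Fin.natAdd_injective _ n (Sum.inl_injective h))
  have h4 : ∀ i, entryAction entry (entryWires n m q) x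
      (.inl (Fin.natAdd n (Fin.castAdd q i))) = _ := fun i => overwrite_apply hinj _ _ i
  refine Prod.ext ?_ (Prod.ext ?_ (Prod.ext ?_ ?_)) <;> funext i
  · exact h1 i
  · exact h2 i
  · exact h4 i
  · exact h3 i

end Registers

/-- The part of the basis on which the sparse matrix acts: system register and term index on the one
hand, and column register, entry register and phase qubit on the other hand. -/
abbrev WalkSpace (n m : ℕ) (I : Type) : Type := (Bits n × I) × (Bits n × Bits m × Fin 2)

section Walk

set_option synthInstance.maxSize 400

variable {n m q : ℕ} {I F : Type}

/-- The registers, with the last `q` qubits read as a phase qubit, a term index and a failure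
label. -/
def coordEquiv (e : Bits q ≃ Fin 2 × I × F) :
    Basis (n + (m + q)) n ≃ WalkSpace n m I × F :=
  (registerEquiv n m q).trans
    { toFun := fun p => (((p.1, (e p.2.2.2).2.1), (p.2.1, p.2.2.1, (e p.2.2.2).1)),
        (e p.2.2.2).2.2)
      invFun := fun y => (y.1.1.1, y.1.2.1, y.1.2.2.1, e.symm (y.1.2.2.2, y.1.1.2, y.2))
      left_inv := fun p => by simp
      right_inv := fun y => by simp }

/-- The column oracle. -/
def colEquiv (σ : Bits n → Equiv.Perm (Bits n)) : WalkSpace n m I ≃ WalkSpace n m I where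
  toFun y := (y.1, (σ y.1.1 y.2.1, y.2.2))
  invFun y := (y.1, ((σ y.1.1).symm y.2.1, y.2.2))
  left_inv y := by simp
  right_inv y := by simp

theorem bits_add_self (z : Bits m) : z + z = 0 := by
  funext i
  have : ∀ a : Fin 2, a + a = 0 := by decide
  exact this _

/-- The entry oracle; the row index is in the column register, the column index in the system
register. -/
def entryEquiv (entry : Bits n → Bits n → Bits m) : WalkSpace n m I ≃ WalkSpace n m I where
  toFun y := (y.1, (y.2.1, y.2.2.1 + entry y.2.1 y.1.1, y.2.2.2))
  invFun y := (y.1, (y.2.1, y.2.2.1 + entry y.2.1 y.1.1, y.2.2.2))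
  left_inv y := by simp [add_assoc, bits_add_self]
  right_inv y := by simp [add_assoc, bits_add_self]

/-- Exchange of the system register and the column register, if the term index is active. -/
def swapEquiv (p : I → Prop) [DecidablePred p] : WalkSpace n m I ≃ WalkSpace n m I where
  toFun y := if p y.1.2 then ((y.2.1, y.1.2), (y.1.1, y.2.2)) else y
  invFun y := if p y.1.2 then ((y.2.1, y.1.2), (y.1.1, y.2.2)) else y
  left_inv y := by by_cases h : p y.1.2 <;> simp [h]
  right_inv y := by by_cases h : p y.1.2 <;> simp [h]

/-- The phases that depend on the entry register, applied if the term index is active. -/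
def phaseVec (p : I → Prop) [DecidablePred p] (φ : Bits m → Fin 2 → ℂ) (y : WalkSpace n m I) : ℂ :=
  if p y.1.2 then φ y.2.2.1 y.2.2.2 else 1

variable [Fintype I] [DecidableEq I]

/-- One application of the sparse matrix, for the active term indices: go from a row to one of its
columns, multiply by the phases for the entry (the entry register is computed before and uncomputed
afterwards), and read the column as the new row. Only the phases and the exchange are conditional,
for otherwise the oracles cancel out. -/
def walkMatrix (σ : Bits n → Equiv.Perm (Bits n)) (entry : Bits n → Bits n → Bits m)
    (p : I → Prop) [DecidablePred p] (φ : Bits m → Fin 2 → ℂ) :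
    Matrix (WalkSpace n m I) (WalkSpace n m I) ℂ :=
  basisMatrix (colEquiv fun j => (σ j).symm) * (basisMatrix (swapEquiv p) *
    (basisMatrix (entryEquiv entry) * (Matrix.diagonal (phaseVec p φ) *
      (basisMatrix (entryEquiv entry) * basisMatrix (colEquiv σ)))))

theorem walkMatrix_mulVec_of_not (σ : Bits n → Equiv.Perm (Bits n))
    (entry : Bits n → Bits n → Bits m) (p : I → Prop) [DecidablePred p] (φ : Bits m → Fin 2 → ℂ)
    (w : WalkSpace n m I → ℂ) {i : I} (hi : ¬ p i) (s a : Bits n) (z : Bits m) (b : Fin 2) :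
    (walkMatrix σ entry p φ).mulVec w ((s, i), (a, z, b)) = w ((s, i), (a, z, b)) := by
  simp only [walkMatrix, ← Matrix.mulVec_mulVec, basisMatrix_mulVec, Matrix.mulVec_diagonal]
  simp [colEquiv, entryEquiv, swapEquiv, phaseVec, hi, add_assoc, bits_add_self]

theorem walkMatrix_mulVec_of_pos (σ : Bits n → Equiv.Perm (Bits n))
    (entry : Bits n → Bits n → Bits m) (p : I → Prop) [DecidablePred p] (φ : Bits m → Fin 2 → ℂ)
    (w : WalkSpace n m I → ℂ) {i : I} (hi : p i) (s a : Bits n) (z : Bits m) (b : Fin 2) :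
    (walkMatrix σ entry p φ).mulVec w ((s, i), (a, z, b)) =
      φ (z + entry s (σ s a)) b * w ((σ s a, i), ((σ (σ s a)).symm s, z, b)) := by
  simp only [walkMatrix, ← Matrix.mulVec_mulVec, basisMatrix_mulVec, Matrix.mulVec_diagonal]
  simp [colEquiv, entryEquiv, swapEquiv, phaseVec, hi, add_assoc, bits_add_self]

variable [Fintype F] [DecidableEq F]

theorem submatrix_mem_unitaryGroup {X Y : Type} [Fintype X] [DecidableEq X] [Fintype Y]
    [DecidableEq Y] (c : X ≃ Y) {M : Matrix Y Y ℂ} (hM : M ∈ Matrix.unitaryGroup Y ℂ) :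
    M.submatrix c c ∈ Matrix.unitaryGroup X ℂ := by
  rw [Matrix.mem_unitaryGroup_iff', Matrix.star_eq_conjTranspose] at hM ⊢
  rw [Matrix.conjTranspose_submatrix, Matrix.submatrix_mul_equiv, hM, Matrix.submatrix_one_equiv]

/-- The free gate for a unitary given in coordinates. -/
def freeGate (e : Bits q ≃ Fin 2 × I × F)
    {M : Matrix (WalkSpace n m I × F) (WalkSpace n m I × F) ℂ}
    (hM : M ∈ Matrix.unitaryGroup (WalkSpace n m I × F) ℂ) : Gate n m (n + (m + q)) :=
  .free ⟨M.submatrix (coordEquiv e) (coordEquiv e), submatrix_mem_unitaryGroup _ hM⟩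

variable {d : ℕ} {val : Bits m → ℂ} {A : Matrix (Bits n) (Bits n) ℂ} (O : SparseOracle d val A)
  (e : Bits q ≃ Fin 2 × I × F)

theorem toUnitary_freeGate {M : Matrix (WalkSpace n m I × F) (WalkSpace n m I × F) ℂ}
    (hM : M ∈ Matrix.unitaryGroup (WalkSpace n m I × F) ℂ) :
    ((freeGate e hM).toUnitary O : Matrix _ _ ℂ) =
      M.submatrix (coordEquiv e) (coordEquiv e) := rfl

omit [Fintype I] [Fintype F] in
theorem basisMatrix_eq_submatrix {g : Basis (n + (m + q)) n → Basis (n + (m + q)) n}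
    {h : WalkSpace n m I ≃ WalkSpace n m I}
    (hgh : ∀ x, coordEquiv e (g x) = h.prodCongr (Equiv.refl F) (coordEquiv e x)) :
    basisMatrix g =
      (basisMatrix h ⊗ₖ (1 : Matrix F F ℂ)).submatrix (coordEquiv e) (coordEquiv e) := by
  rw [basisMatrix_kronecker_one]
  ext x y
  simp only [basisMatrix, Matrix.submatrix_apply, Matrix.of_apply, ← hgh,
    (coordEquiv e).apply_eq_iff_eq]

omit [Fintype I] [Fintype F] in
theorem toUnitary_colQuery (inv : Bool) :
    ((Gate.colQuery (colWires n m q) inv : Gate n m (n + (m + q))).toUnitary O :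
        Matrix (Basis (n + (m + q)) n) _ ℂ) =
      (basisMatrix (colEquiv fun j => if inv then (O.col j).symm else O.col j) ⊗ₖ
        (1 : Matrix F F ℂ)).submatrix (coordEquiv e) (coordEquiv e) :=
  basisMatrix_eq_submatrix e fun x => by
    simp only [coordEquiv, Equiv.trans_apply, registerEquiv_colAction]
    rfl

omit [Fintype I] [Fintype F] in
theorem toUnitary_entryQuery :
    ((Gate.entryQuery (entryWires n m q)).toUnitary O :
        Matrix (Basis (n + (m + q)) n) _ ℂ) =
      (basisMatrix (entryEquiv O.entry) ⊗ₖ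
        (1 : Matrix F F ℂ)).submatrix (coordEquiv e) (coordEquiv e) :=
  basisMatrix_eq_submatrix e fun x => by
    simp only [coordEquiv, Equiv.trans_apply, registerEquiv_entryAction]
    rfl

theorem circuitUnitary_append {t : ℕ} (c₁ c₂ : List (Gate n m t)) :
    circuitUnitary O (c₁ ++ c₂) = circuitUnitary O c₂ * circuitUnitary O c₁ := by
  induction c₁ with
  | nil => simp [circuitUnitary]
  | cons g c ih => simp [circuitUnitary, ih, mul_assoc]

theorem phaseVec_mem {p : I → Prop} [DecidablePred p] {φ : Bits m → Fin 2 → ℂ}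
    (hφ : ∀ z b, star (φ z b) * φ z b = 1) :
    Matrix.diagonal (phaseVec (n := n) p φ) ∈ Matrix.unitaryGroup (WalkSpace n m I) ℂ :=
  diagonal_mem_unitaryGroup fun y => by
    by_cases h : p y.1.2 <;> simp only [phaseVec, h, if_true, if_false, hφ, star_one, mul_one]

/-- One application of the sparse matrix for the active term indices, followed by the measurement
of the projection `P`, whose failure is recorded as an exchange of the labels `f₀` and `f₁`. -/
def walkStep (p : I → Prop) [DecidablePred p] {φ : Bits m → Fin 2 → ℂ}
    (hφ : ∀ z b, star (φ z b) * φ z b = 1) {P : Matrix (WalkSpace n m I) (WalkSpace n m I) ℂ}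
    (hP : P.conjTranspose = P) (hPP : P * P = P) (f₀ f₁ : F) : List (Gate n m (n + (m + q))) :=
  [.colQuery (colWires n m q) false, .entryQuery (entryWires n m q),
    freeGate e (kronecker_one_mem (phaseVec_mem (p := p) hφ)),
    .entryQuery (entryWires n m q),
    freeGate e (kronecker_one_mem (basisMatrix_equiv_mem (swapEquiv p))),
    .colQuery (colWires n m q) true, freeGate e (recordMatrix_mem hP hPP f₀ f₁)]

theorem circuitUnitary_walkStep (p : I → Prop) [DecidablePred p] {φ : Bits m → Fin 2 → ℂ}
    (hφ : ∀ z b, star (φ z b) * φ z b = 1) {P : Matrix (WalkSpace n m I) (WalkSpace n m I) ℂ}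
    (hP : P.conjTranspose = P) (hPP : P * P = P) (f₀ f₁ : F) :
    (circuitUnitary O (walkStep e p hφ hP hPP f₀ f₁) : Matrix _ _ ℂ) =
      (recordMatrix P f₀ f₁ * (walkMatrix O.col O.entry p φ ⊗ₖ 1)).submatrix
        (coordEquiv e) (coordEquiv e) := by
  simp only [walkStep, circuitUnitary, one_mul, Submonoid.coe_mul, toUnitary_freeGate,
    toUnitary_colQuery O e, toUnitary_entryQuery O e, Matrix.submatrix_mul_equiv, mul_assoc,
    ← Matrix.mul_kronecker_mul, walkMatrix, if_true, Bool.false_eq_true, if_false]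

/-- The steps number `0, …, k - 1`; in step `j`, the term indices above `j` are active. -/
def walkSteps (idx : I → ℕ) {φ : Bits m → Fin 2 → ℂ}
    (hφ : ∀ z b, star (φ z b) * φ z b = 1) {P : Matrix (WalkSpace n m I) (WalkSpace n m I) ℂ}
    (hP : P.conjTranspose = P) (hPP : P * P = P) (l : ℕ → F) :
    ℕ → List (Gate n m (n + (m + q)))
  | 0 => []
  | k + 1 => walkSteps idx hφ hP hPP l k ++ walkStep e (k < idx ·) hφ hP hPP (l 0) (l (k + 1))

theorem circuitUnitary_walkSteps (idx : I → ℕ) {φ : Bits m → Fin 2 → ℂ}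
    (hφ : ∀ z b, star (φ z b) * φ z b = 1) {P : Matrix (WalkSpace n m I) (WalkSpace n m I) ℂ}
    (hP : P.conjTranspose = P) (hPP : P * P = P) (l : ℕ → F) (k : ℕ) :
    (circuitUnitary O (walkSteps e idx hφ hP hPP l k) : Matrix _ _ ℂ) =
      (recordedProduct P (fun j => walkMatrix O.col O.entry (j < idx ·) φ) l k).submatrix
        (coordEquiv e) (coordEquiv e) := by
  induction k with
  | zero => simp [walkSteps, circuitUnitary, recordedProduct]
  | succ k ih =>
    rw [walkSteps, circuitUnitary_append, Submonoid.coe_mul, ih, circuitUnitary_walkStep,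
      Matrix.submatrix_mul_equiv, recordedProduct]

theorem queryCount_walkSteps (idx : I → ℕ) {φ : Bits m → Fin 2 → ℂ}
    (hφ : ∀ z b, star (φ z b) * φ z b = 1) {P : Matrix (WalkSpace n m I) (WalkSpace n m I) ℂ}
    (hP : P.conjTranspose = P) (hPP : P * P = P) (l : ℕ → F) (k : ℕ) :
    queryCount (walkSteps e idx hφ hP hPP l k) = 4 * k := by
  induction k with
  | zero => rfl
  | succ k ih =>
    have h : queryCount (walkStep e (k < idx ·) hφ hP hPP (l 0) (l (k + 1))) = 4 := rfl
    rw [queryCount, walkSteps, List.map_append, List.sum_append]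
    rw [queryCount] at ih h
    rw [ih, h]
    ring

end Walk

/-! ### Amplitudes of the circuit -/

section Amplitudes

set_option synthInstance.maxSize 400

variable {n m q : ℕ} {I F : Type}

theorem mulVec_initialState {t : ℕ} {Y : Type} (M : Matrix Y (Basis t n) ℂ)
    (ψ : EuclideanSpace ℂ (Bits n)) :
    M.mulVec (initialState t ψ) = (M.submatrix id (Sum.elim 0)).mulVec ψ := by
  funext y
  simp only [Matrix.mulVec, dotProduct, Matrix.submatrix_apply, id]
  rw [← (Equiv.sumArrowEquivProdArrow (Fin t) (Fin n) (Fin 2)).symm.sum_comp,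
    Fintype.sum_prod_type, Finset.sum_eq_single 0]
  · refine Finset.sum_congr rfl fun s _ => ?_
    simp only [initialState, Equiv.sumArrowEquivProdArrow_symm_apply_inl,
      Equiv.sumArrowEquivProdArrow_symm_apply_inr, Pi.zero_apply, implies_true, if_true]
    rfl
  · intro a _ ha
    refine Finset.sum_eq_zero fun s _ => ?_
    have : ¬ ∀ i, a i = 0 := fun h => ha (funext h)
    simp only [initialState, Equiv.sumArrowEquivProdArrow_symm_apply_inl, this, if_false, mul_zero]
  · simp

/-- The uniform superposition of the columns in `D`, with the entry register `0` and the phase qubit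
in the state `(|0⟩ + |1⟩) / √2`. -/
def workState (D : Finset (Bits n)) (g : Bits n × Bits m × Fin 2) : ℂ :=
  if g.1 ∈ D ∧ g.2.1 = 0 then ((√(2 * D.card))⁻¹ : ℝ) else 0

theorem star_workState (D : Finset (Bits n)) (g : Bits n × Bits m × Fin 2) :
    star (workState D g) = workState D g := by
  unfold workState
  split_ifs <;> simp

theorem inv_sqrt_mul_self {D : Finset (Bits n)} :
    (((√(2 * D.card))⁻¹ : ℝ) : ℂ) * (((√(2 * D.card))⁻¹ : ℝ) : ℂ) = (2 * D.card : ℂ)⁻¹ := by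
  rw [← Complex.ofReal_mul, ← mul_inv, Real.mul_self_sqrt (by positivity)]
  simp

theorem sum_workState_mul_self {D : Finset (Bits n)} (hD : D.Nonempty) :
    ∑ g : Bits n × Bits m × Fin 2, workState D g * workState D g = 1 := by
  have h : ∀ g : Bits n × Bits m × Fin 2, workState D g * workState D g =
      (if g.1 ∈ D then if g.2.1 = 0 then (2 * D.card : ℂ)⁻¹ else 0 else 0) := fun g => by
    by_cases h1 : g.1 ∈ D <;> by_cases h2 : g.2.1 = 0 <;>
      simp only [workState, h1, h2, true_and, false_and, if_true, if_false, inv_sqrt_mul_self,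
        mul_zero]
  have hc : (D.card : ℂ) ≠ 0 := Nat.cast_ne_zero.2 hD.card_pos.ne'
  simp only [h, Fintype.sum_prod_type, Finset.sum_ite_irrel, Finset.sum_const_zero,
    Finset.sum_ite_mem, Finset.univ_inter]
  simp
  field_simp

variable [Fintype I] [DecidableEq I]

/-- The projection onto the states whose second tensor factor is `workState D`. -/
def workProj (I : Type) [DecidableEq I] (m : ℕ) (D : Finset (Bits n)) :
    Matrix (WalkSpace n m I) (WalkSpace n m I) ℂ :=
  (1 : Matrix (Bits n × I) (Bits n × I) ℂ) ⊗ₖ Matrix.vecMulVec (workState D) (workState D)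

omit [Fintype I] in
theorem workProj_conjTranspose (D : Finset (Bits n)) :
    (workProj I m D).conjTranspose = workProj I m D := by
  rw [workProj, Matrix.conjTranspose_kronecker, Matrix.conjTranspose_one]
  congr 1
  ext g g'
  rw [Matrix.conjTranspose_apply, Matrix.vecMulVec_apply, Matrix.vecMulVec_apply, star_mul,
    star_workState, star_workState]

theorem workProj_mul_self {D : Finset (Bits n)} (hD : D.Nonempty) :
    workProj I m D * workProj I m D = workProj I m D := by
  rw [workProj, ← Matrix.mul_kronecker_mul, one_mul, Matrix.vecMulVec_mul_vecMulVec]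
  congr 1
  have : (workState (m := m) D) ⬝ᵥ (workState D) = 1 := sum_workState_mul_self hD
  rw [this]
  simp

theorem workProj_mulVec (D : Finset (Bits n)) (w : WalkSpace n m I → ℂ) :
    (workProj I m D).mulVec w =
      fun y => (∑ g, workState D g * w (y.1, g)) * workState D y.2 := by
  funext ⟨t, g⟩
  simp only [workProj, Matrix.mulVec, dotProduct,
    Fintype.sum_prod_type (f := fun y : (Bits n × I) × _ => _), Matrix.kroneckerMap_apply,
    Matrix.vecMulVec_apply, Matrix.one_apply]
  rw [Finset.sum_eq_single t]
  · rw [Finset.sum_mul]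
    refine Finset.sum_congr rfl fun g' _ => ?_
    rw [if_pos rfl]
    ring
  · intro t' _ ht
    refine Finset.sum_eq_zero fun g' _ => ?_
    rw [if_neg ht.symm]
    ring
  · simp

/-- The block-encoding identity: between two copies of `workState D`, the walk acts on the active
term indices as `A / #D`. -/
theorem workProj_walkMatrix_mulVec {σ : Bits n → Equiv.Perm (Bits n)}
    {entry : Bits n → Bits n → Bits m} {φ : Bits m → Fin 2 → ℂ} {A : Matrix (Bits n) (Bits n) ℂ}
    {D : Finset (Bits n)} (hD : D.Nonempty)
    (hφ : ∀ j k, φ (entry j k) 0 + φ (entry j k) 1 = 2 * A j k)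
    (hA : A.IsHermitian) (hσ : ∀ j k, A j k ≠ 0 → (σ j).symm k ∈ D)
    (p : I → Prop) [DecidablePred p] (v : Bits n × I → ℂ) :
    (workProj I m D * walkMatrix σ entry p φ).mulVec (fun y => v y.1 * workState D y.2) =
      fun y => (if p y.1.2 then (((D.card : ℂ)⁻¹ • A).mulVec fun s => v (s, y.1.2)) y.1.1
        else v y.1) * workState D y.2 := by
  rw [← Matrix.mulVec_mulVec, workProj_mulVec]
  funext ⟨⟨s, i⟩, g⟩
  congr 1
  by_cases hi : p i
  · simp only [hi, if_true]
    have h : ∀ a : Bits n, ∀ z : Bits m, ∀ b : Fin 2, workState D (a, z, b) *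
        (walkMatrix σ entry p φ).mulVec (fun y => v y.1 * workState D y.2) ((s, i), (a, z, b)) =
        if z = 0 then (if a ∈ D ∧ (σ (σ s a)).symm s ∈ D then
          φ (entry s (σ s a)) b * (v (σ s a, i) * (2 * D.card : ℂ)⁻¹) else 0) else 0 := by
      intro a z b
      rw [walkMatrix_mulVec_of_pos _ _ _ _ _ hi, ← inv_sqrt_mul_self]
      by_cases hz : z = 0 <;> by_cases h1 : a ∈ D <;> by_cases h2 : (σ (σ s a)).symm s ∈ D <;>
        simp only [workState, hz, h1, h2, and_true, and_false, if_true, if_false, zero_add,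
          mul_zero, zero_mul]
      ring
    have h' : ∀ a : Bits n, ∑ z : Bits m, ∑ b : Fin 2, workState D (a, z, b) *
        (walkMatrix σ entry p φ).mulVec (fun y => v y.1 * workState D y.2) ((s, i), (a, z, b)) =
        (D.card : ℂ)⁻¹ * A s (σ s a) * v (σ s a, i) := by
      intro a
      simp only [h]
      rw [Finset.sum_eq_single 0 (by intro z _ hz; simp [hz]) (by simp)]
      simp only [if_true, Fin.sum_univ_two]
      by_cases hA0 : A s (σ s a) = 0
      · have := hφ s (σ s a)
        rw [hA0] at this ⊢
        split_ifs
        · rw [← add_mul, this]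
          ring
        · ring
      · have h1 : a ∈ D := by simpa using hσ _ _ hA0
        have h2 : (σ (σ s a)).symm s ∈ D := hσ _ _ fun h0 => hA0 (by
          rw [← hA.apply, h0, star_zero])
        rw [if_pos ⟨h1, h2⟩, if_pos ⟨h1, h2⟩, ← add_mul, hφ]
        have hc : (D.card : ℂ) ≠ 0 := Nat.cast_ne_zero.2 hD.card_pos.ne'
        field_simp
    rw [Fintype.sum_prod_type]
    simp only [Fintype.sum_prod_type, h']
    rw [Equiv.sum_comp (σ s) fun k => (D.card : ℂ)⁻¹ * A s k * v (k, i)]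
    simp [Matrix.mulVec, dotProduct]
  · simp only [hi, if_false]
    have h : ∀ g' : Bits n × Bits m × Fin 2, workState D g' *
        (walkMatrix σ entry p φ).mulVec (fun y => v y.1 * workState D y.2) ((s, i), g') =
        v (s, i) * (workState D g' * workState D g') := by
      rintro ⟨a, z, b⟩
      rw [walkMatrix_mulVec_of_not _ _ _ _ _ hi]
      ring
    simp only [h]
    rw [← Finset.mul_sum, sum_workState_mul_self hD, mul_one]

/-- After `k` steps, the component with term index `i` carries the power `min k (idx i)` of the
block-encoded matrix. -/
theorem projectedProduct_mulVec {σ : Bits n → Equiv.Perm (Bits n)}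
    {entry : Bits n → Bits n → Bits m} {φ : Bits m → Fin 2 → ℂ} {A : Matrix (Bits n) (Bits n) ℂ}
    {D : Finset (Bits n)} (hD : D.Nonempty)
    (hφ : ∀ j k, φ (entry j k) 0 + φ (entry j k) 1 = 2 * A j k)
    (hA : A.IsHermitian) (hσ : ∀ j k, A j k ≠ 0 → (σ j).symm k ∈ D)
    (idx : I → ℕ) (v : I → ℂ) (ψ : Bits n → ℂ) (k : ℕ) :
    (projectedProduct (workProj I m D) (fun j => walkMatrix σ entry (j < idx ·) φ) k).mulVec
      (fun y => v y.1.2 * ψ y.1.1 * workState D y.2) =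
      fun y => v y.1.2 * ((((D.card : ℂ)⁻¹ • A) ^ min k (idx y.1.2)).mulVec ψ) y.1.1 *
        workState D y.2 := by
  induction k with
  | zero => simp [projectedProduct]
  | succ k ih =>
    rw [projectedProduct, ← Matrix.mulVec_mulVec, ih,
      workProj_walkMatrix_mulVec hD hφ hA hσ (k < idx ·) fun t =>
        v t.2 * ((((D.card : ℂ)⁻¹ • A) ^ min k (idx t.2)).mulVec ψ) t.1]
    funext ⟨⟨s, i⟩, g⟩
    congr 1
    simp only
    by_cases h : k < idx i
    · rw [if_pos h, min_eq_left h.le, min_eq_left h, pow_succ', ← Matrix.mulVec_mulVec]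
      exact congrFun (Matrix.mulVec_smul _ (v i) _) s
    · rw [if_neg h, min_eq_right (by omega), min_eq_right (by omega)]

variable [Fintype F] [DecidableEq F]

/-- The isometry `|s⟩ ↦ ∑ i, η i |s, i⟩ ⊗ workState D ⊗ |f₀⟩`. -/
def embedMatrix (D : Finset (Bits n)) (η : I → ℝ) (f₀ : F) :
    Matrix (WalkSpace n m I × F) (Bits n) ℂ :=
  Matrix.of fun x s => if x.2 = f₀ then if x.1.1.1 = s then η x.1.1.2 * workState D x.1.2 else 0
    else 0

omit [Fintype I] [DecidableEq I] [Fintype F] in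
theorem embedMatrix_mulVec (D : Finset (Bits n)) (η : I → ℝ) (f₀ : F) (ψ : Bits n → ℂ)
    (x : WalkSpace n m I × F) :
    (embedMatrix D η f₀).mulVec ψ x =
      if x.2 = f₀ then η x.1.1.2 * ψ x.1.1.1 * workState D x.1.2 else 0 := by
  simp only [embedMatrix, Matrix.mulVec, dotProduct, Matrix.of_apply]
  split_ifs
  · rw [Finset.sum_eq_single x.1.1.1 (by intro s _ hs; simp [hs.symm]) (by simp), if_pos rfl]
    ring
  · simp

omit [DecidableEq I] in
theorem embedMatrix_conjTranspose_mulVec {D : Finset (Bits n)} (hD : D.Nonempty) (η : I → ℝ)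
    (f₀ : F) (w : WalkSpace n m I × F → ℂ) (v : Bits n × I → ℂ)
    (hw : ∀ y, w (y, f₀) = v y.1 * workState D y.2) (s : Bits n) :
    (embedMatrix D η f₀).conjTranspose.mulVec w s = ∑ i, η i * v (s, i) := by
  simp only [embedMatrix, Matrix.mulVec, dotProduct, Matrix.conjTranspose_apply, Matrix.of_apply]
  rw [Fintype.sum_prod_type, Fintype.sum_prod_type, Fintype.sum_prod_type,
    Finset.sum_eq_single s]
  · refine Finset.sum_congr rfl fun i _ => ?_
    have h : ∀ g : Bits n × Bits m × Fin 2, (∑ f : F, star (if f = f₀ then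
        if s = s then (η i : ℂ) * workState D g else 0 else 0) * w (((s, i), g), f)) =
        η i * v (s, i) * (workState D g * workState D g) := fun g => by
      rw [Finset.sum_eq_single f₀ (by intro f _ hf; simp [hf]) (by simp), if_pos rfl, if_pos rfl,
        hw, star_mul, star_workState]
      simp only [RCLike.star_def, Complex.conj_ofReal]
      ring
    rw [Finset.sum_congr rfl fun g _ => h g, ← Finset.mul_sum, sum_workState_mul_self hD, mul_one]
  · intro s' _ hs
    simp [hs]
  · simp

omit [DecidableEq I] in
theorem embedMatrix_isometry {D : Finset (Bits n)} (hD : D.Nonempty) {η : I → ℝ}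
    (hη : ∑ i, η i * η i = 1) (f₀ : F) :
    (embedMatrix (m := m) D η f₀).conjTranspose * embedMatrix (m := m) D η f₀ = 1 := by
  refine Matrix.ext_of_mulVec_single fun s => ?_
  rw [← Matrix.mulVec_mulVec, Matrix.one_mulVec]
  funext s'
  rw [embedMatrix_conjTranspose_mulVec hD η f₀ _ (fun t => η t.2 * (Pi.single s 1 : _ → ℂ) t.1)
    (fun y => by rw [embedMatrix_mulVec, if_pos rfl])]
  simp only [← mul_assoc]
  rw [← Finset.sum_mul]
  have : ∑ i, (η i : ℂ) * η i = 1 := by exact_mod_cast congrArg ((↑) : ℝ → ℂ) hη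
  rw [this, one_mul]

/-- Linear combinations of powers: if `u` and `v` are unit vectors, then there is a circuit with
`4 L` queries that prepares `∑ i, u i * v i * (A / #D) ^ min L (idx i)`, applied to the input
state. -/
theorem exists_circuit_of_unit_vectors (e : Bits q ≃ Fin 2 × I × F) {D : Finset (Bits n)}
    (hD : D.Nonempty) (val : Bits m → ℂ) (idx : I → ℕ) {L : ℕ} {l : ℕ → F}
    (hl : Set.InjOn l (Set.Iic L)) {u v : I → ℝ} (hu : ∑ i, u i * u i = 1)
    (hv : ∑ i, v i * v i = 1) :
    ∃ circ : List (Gate n m (n + (m + q))), queryCount circ = 4 * L ∧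
      ∀ (d : ℕ) (A : Matrix (Bits n) (Bits n) ℂ), A.IsHermitian → (∀ j k, ‖A j k‖ ≤ 1) →
        ∀ O : SparseOracle d val A, (∀ j k, A j k ≠ 0 → (O.col j).symm k ∈ D) →
        ∀ (ψ : EuclideanSpace ℂ (Bits n)) (s : Bits n),
          branch (circuitUnitary O circ) 0 ψ s =
            ∑ i, (u i * v i : ℂ) * ((((D.card : ℂ)⁻¹ • A) ^ min L (idx i)).mulVec ψ) s := by
  choose φ hφ1 hφ2 using fun z => exists_phases (val z)
  set c := coordEquiv (n := n) (m := m) e with hc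
  have hκ : Function.Injective fun s : Bits n =>
      c (Sum.elim (0 : Fin (n + (m + q)) → Fin 2) s) := by
    intro s s' h
    funext i
    exact congrFun (c.injective h) (.inr i)
  obtain ⟨Uv, hUv, hUv'⟩ := exists_unitary_apply_eq hκ (embedMatrix_isometry (m := m) hD hv (l 0))
  obtain ⟨Uu, hUu, hUu'⟩ := exists_unitary_apply_eq hκ (embedMatrix_isometry (m := m) hD hu (l 0))
  have hP := workProj_conjTranspose (I := I) (m := m) D
  have hPP := workProj_mul_self (I := I) (m := m) hD
  refine ⟨freeGate e hUv :: (walkSteps e idx hφ1 hP hPP l L ++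
    [freeGate e (Unitary.star_mem hUu)]), ?_, ?_⟩
  · have := queryCount_walkSteps e idx hφ1 hP hPP l L
    rw [queryCount] at this ⊢
    simp only [List.map_cons, List.sum_cons, List.map_append, List.sum_append, List.map_nil,
      List.sum_nil, this, freeGate, Gate.queries]
    ring
  · intro d A hA hA1 O hO ψ s
    set W := recordedProduct (workProj I m D)
      (fun j => walkMatrix O.col O.entry (j < idx ·) φ) l L with hW
    have hcirc : (circuitUnitary O (freeGate e hUv :: (walkSteps e idx hφ1 hP hPP l L ++
        [freeGate e (Unitary.star_mem hUu)])) : Matrix _ _ ℂ) =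
        (star Uu * W * Uv).submatrix c c := by
      rw [circuitUnitary, circuitUnitary_append, Submonoid.coe_mul, Submonoid.coe_mul,
        circuitUnitary_walkSteps, circuitUnitary, circuitUnitary, one_mul, toUnitary_freeGate,
        toUnitary_freeGate, Matrix.submatrix_mul_equiv, Matrix.submatrix_mul_equiv]
    have hcols : (star Uu * W * Uv).submatrix
        (fun s : Bits n => c (Sum.elim (0 : Fin (n + (m + q)) → Fin 2) s))
        (fun s : Bits n => c (Sum.elim (0 : Fin (n + (m + q)) → Fin 2) s)) =
        (embedMatrix (m := m) D u (l 0)).conjTranspose * W * embedMatrix (m := m) D v (l 0) := by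
      have h1 : Uv.submatrix id
          (fun s : Bits n => c (Sum.elim (0 : Fin (n + (m + q)) → Fin 2) s)) =
          embedMatrix (m := m) D v (l 0) := by
        ext x t
        exact hUv' x t
      have h2 : (star Uu).submatrix
          (fun s : Bits n => c (Sum.elim (0 : Fin (n + (m + q)) → Fin 2) s)) id =
          (embedMatrix (m := m) D u (l 0)).conjTranspose := by
        ext t x
        exact congrArg star (hUu' x t)
      rw [← h1, ← h2, Matrix.submatrix_mul _ _ _ id _ Function.bijective_id,
        Matrix.submatrix_mul _ _ _ id _ Function.bijective_id, Matrix.submatrix_id_id]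
    have hbranch : branch (circuitUnitary O (freeGate e hUv :: (walkSteps e idx hφ1 hP hPP l L ++
        [freeGate e (Unitary.star_mem hUu)]))) 0 ψ s =
        ((embedMatrix (m := m) D u (l 0)).conjTranspose * W *
          embedMatrix (m := m) D v (l 0)).mulVec ψ s := by
      rw [← hcols]
      simp only [branch]
      rw [hcirc, Matrix.ofLp_toEuclideanCLM, mulVec_initialState]
      rfl
    rw [hbranch, ← Matrix.mulVec_mulVec, ← Matrix.mulVec_mulVec]
    obtain ⟨hgood, -⟩ := recordedProduct_mulVec (workProj I m D)
      (fun j => walkMatrix O.col O.entry (j < idx ·) φ) hl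
      (w := (embedMatrix (m := m) D v (l 0)).mulVec ψ)
      (fun x f hf => by rw [embedMatrix_mulVec, if_neg hf]) L le_rfl
    have hφ3 : ∀ j k, φ (O.entry j k) 0 + φ (O.entry j k) 1 = 2 * A j k := fun j k => by
      rw [hφ2 _ (by rw [O.val_entry]; exact hA1 j k), O.val_entry]
    have hstart : (fun y => (embedMatrix (m := m) D v (l 0)).mulVec ψ (y, l 0)) =
        fun y => (v y.1.2 : ℂ) * ψ y.1.1 * workState D y.2 := by
      funext y
      rw [embedMatrix_mulVec, if_pos rfl]
    rw [embedMatrix_conjTranspose_mulVec hD u (l 0) _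
      (fun t => v t.2 * ((((D.card : ℂ)⁻¹ • A) ^ min L (idx t.2)).mulVec ψ) t.1)]
    · refine Finset.sum_congr rfl fun i _ => ?_
      rw [mul_assoc]
    · intro y
      rw [hgood, hstart, projectedProduct_mulVec hD hφ3 hA hO idx (fun i => (v i : ℂ))]

end Amplitudes

/-! ### Polynomials of a sparse matrix -/

theorem sum_fin_eq_of_eq_zero {α : Type*} [AddCommMonoid α] {L N : ℕ} (hN : L + 3 ≤ N) {g : ℕ → α}
    (hg : ∀ i, L + 3 ≤ i → g i = 0) :
    ∑ i : Fin N, g i = ∑ i ∈ Finset.range (L + 1), g i + g (L + 1) + g (L + 2) := by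
  rw [Fin.sum_univ_eq_sum_range g N, ← Finset.sum_range_succ, ← Finset.sum_range_succ]
  refine (Finset.sum_subset (Finset.range_subset_range.2 hN) fun i _ hi => hg i ?_).symm
  simpa using hi

/-- Coefficients of total weight at most one are the entrywise products of two unit vectors. The
excess of either vector is kept in a coordinate where the other one vanishes. -/
theorem exists_unit_vectors {L N : ℕ} (hN : L + 3 ≤ N) {β : ℕ → ℝ}
    (hβ : ∑ i ∈ Finset.range (L + 1), |β i| ≤ 1) :
    ∃ u v : ℕ → ℝ, ∑ i : Fin N, u i * u i = 1 ∧ ∑ i : Fin N, v i * v i = 1 ∧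
      (∀ i ≤ L, u i * v i = β i) ∧ ∀ i, L < i → u i * v i = 0 := by
  set r := 1 - ∑ i ∈ Finset.range (L + 1), |β i| with hr
  have hr0 : 0 ≤ r := by linarith
  let u : ℕ → ℝ := fun i => if i ≤ L then SignType.sign (β i) * √|β i| else
    if i = L + 1 then √r else 0
  let v : ℕ → ℝ := fun i => if i ≤ L then √|β i| else if i = L + 2 then √r else 0
  -- where `β i = 0`, the vector `u` has the entry `0` and so has `v`
  have hu : ∀ i ≤ L, u i * u i = |β i| := fun i hi => by
    simp only [u, if_pos hi]
    rcases lt_trichotomy (β i) 0 with h | h | h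
    · simp [h]
    · simp [h]
    · simp [h]
  have hv : ∀ i ≤ L, v i * v i = |β i| := fun i hi => by
    simp only [v, if_pos hi]
    exact Real.mul_self_sqrt (abs_nonneg _)
  have hmem : ∀ i ∈ Finset.range (L + 1), i ≤ L := fun i hi => by
    have := Finset.mem_range.1 hi
    omega
  refine ⟨u, v, ?_, ?_, fun i hi => ?_, fun i hi => ?_⟩
  · rw [sum_fin_eq_of_eq_zero hN (g := fun i => u i * u i) fun i hi => by
      simp only [u]
      rw [if_neg (by omega), if_neg (by omega), mul_zero],
      Finset.sum_congr rfl fun i hi => hu i (hmem i hi)]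
    simp [u, Real.mul_self_sqrt hr0]
    linarith
  · rw [sum_fin_eq_of_eq_zero hN (g := fun i => v i * v i) fun i hi => by
      simp only [v]
      rw [if_neg (by omega), if_neg (by omega), mul_zero],
      Finset.sum_congr rfl fun i hi => hv i (hmem i hi)]
    simp [v, Real.mul_self_sqrt hr0]
    linarith
  · simp only [u, v, if_pos hi]
    rw [mul_assoc, Real.mul_self_sqrt (abs_nonneg _), sign_mul_abs]
  · simp only [u, v, if_neg hi.not_ge]
    by_cases h : i = L + 1
    · rw [if_neg (show ¬ i = L + 2 by omega), mul_zero]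
    · rw [if_neg h, zero_mul]

theorem eq_zero_of_isRowSparse_zero {n : ℕ} {A : Matrix (Bits n) (Bits n) ℂ}
    (hA : IsRowSparse 0 A) : A = 0 := by
  ext j k
  have h := (Set.ncard_eq_zero (Set.toFinite _)).1 (Nat.le_zero.1 (hA j))
  by_contra hjk
  have : k ∈ {k | A j k ≠ 0} := hjk
  rw [h] at this
  exact this

/-- A polynomial of degree `L` in a `d`-sparse matrix is prepared with `4 L` queries, with the
subnormalization given by the weight of its coefficients. -/
theorem exists_circuit_polynomial (n d m : ℕ) (val : Bits m → ℂ) (b : ℕ → ℝ) (L : ℕ) {γ : ℝ}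
    (hγ : 0 < γ) (hb : ∑ i ∈ Finset.range (L + 1), (d : ℝ) ^ i * |b i| ≤ γ) :
    ∃ (t : ℕ) (circ : List (Gate n m t)), queryCount circ = 4 * L ∧
      ∀ A : Matrix (Bits n) (Bits n) ℂ, A.IsHermitian → IsRowSparse d A → (∀ j k, ‖A j k‖ ≤ 1) →
        ∀ (O : SparseOracle d val A) (ψ : EuclideanSpace ℂ (Bits n)),
          branch (circuitUnitary O circ) 0 ψ = ((γ⁻¹ : ℝ) : ℂ) •
            Matrix.toEuclideanCLM (𝕜 := ℂ) (∑ i ∈ Finset.range (L + 1), (b i : ℂ) • A ^ i) ψ := by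
  -- The relevant columns; for `d = 0`, one of them is kept to have a state to superpose.
  let D : Finset (Bits n) :=
    Finset.univ.filter fun a => (finFunctionFinEquiv a : ℕ) < max d 1
  have hD : D.Nonempty := ⟨finFunctionFinEquiv.symm ⟨0, by positivity⟩,
    Finset.mem_filter.2 ⟨Finset.mem_univ _, by
      rw [Equiv.apply_symm_apply]
      exact lt_max_of_lt_right one_pos⟩⟩
  have hDcard : D.card ≤ max d 1 := by
    have h := Finset.card_le_card_of_injOn (s := D) (t := Finset.range (max d 1))
      (fun a => (finFunctionFinEquiv a : ℕ)) (fun a ha => by simpa [D] using ha)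
      (fun a _ a' _ h => finFunctionFinEquiv.injective (Fin.ext h))
    simpa using h
  have hc : (D.card : ℂ) ≠ 0 := Nat.cast_ne_zero.2 hD.card_pos.ne'
  -- `w i` is the factor that turns the `i`-th power of `A / #D` into that of `A`.
  let w : ℕ → ℝ := fun i => if d = 0 ∧ i ≠ 0 then 0 else (D.card : ℝ) ^ i
  have hw0 : ∀ i, 0 ≤ w i := fun i => by
    simp only [w]
    split_ifs <;> positivity
  have hwd : ∀ i, w i ≤ (d : ℝ) ^ i := fun i => by
    simp only [w]
    split_ifs with h
    · positivity
    · rcases Nat.eq_zero_or_pos d with hd | hd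
      · have : i = 0 := by
          by_contra hi
          exact h ⟨hd, hi⟩
        simp [this]
      · gcongr
        rwa [max_eq_left hd] at hDcard
  have hwA : ∀ A : Matrix (Bits n) (Bits n) ℂ, IsRowSparse d A → ∀ i,
      (w i : ℂ) • ((D.card : ℂ)⁻¹ • A) ^ i = A ^ i := fun A hA i => by
    simp only [w]
    split_ifs with h
    · rw [h.1] at hA
      rw [eq_zero_of_isRowSparse_zero hA]
      simp [h.2]
    · rw [smul_pow, smul_smul]
      push_cast
      rw [← mul_pow, mul_inv_cancel₀ hc, one_pow, one_smul]
  have hβ : ∑ i ∈ Finset.range (L + 1), |γ⁻¹ * (b i * w i)| ≤ 1 := by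
    simp only [abs_mul, ← Finset.mul_sum, abs_inv, abs_of_pos hγ]
    rw [inv_mul_le_one₀ hγ]
    refine le_trans (Finset.sum_le_sum fun i _ => ?_) hb
    rw [abs_of_nonneg (hw0 i), mul_comm]
    gcongr
    exact hwd i
  have hN : L + 3 ≤ 2 ^ (L + 2) := Nat.lt_two_pow_self (n := L + 2)
  obtain ⟨u, v, hu, hv, huv, huv0⟩ := exists_unit_vectors hN hβ
  let e : Bits (1 + (L + 2) + (L + 2)) ≃ Fin 2 × Fin (2 ^ (L + 2)) × Fin (2 ^ (L + 2)) :=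
    Fintype.equivOfCardEq (by simp; ring)
  have hl : Set.InjOn (fun k => Fin.ofNat (2 ^ (L + 2)) k) (Set.Iic L) := by
    intro j hj k hk h
    have h' := congrArg Fin.val h
    simp only [Fin.val_ofNat, Set.mem_Iic] at h' hj hk
    rwa [Nat.mod_eq_of_lt (by omega), Nat.mod_eq_of_lt (by omega)] at h'
  obtain ⟨circ, hq, hcirc⟩ := exists_circuit_of_unit_vectors (m := m) e hD val
    (fun i : Fin (2 ^ (L + 2)) => (i : ℕ)) hl (u := fun i => u i) (v := fun i => v i) hu hv
  refine ⟨_, circ, hq, fun A hA hAs hA1 O ψ => ?_⟩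
  ext s
  rw [hcirc d A hA hA1 O (fun j k hjk => ?_) ψ s,
    sum_fin_eq_of_eq_zero hN (g := fun i =>
      (u i * v i : ℂ) * ((((D.card : ℂ)⁻¹ • A) ^ min L i).mulVec ψ) s)]
  · have h0 : ∀ i, L < i → (u i * v i : ℂ) = 0 := fun i hi => by
      rw [← Complex.ofReal_mul, huv0 i hi, Complex.ofReal_zero]
    rw [h0 (L + 1) (by omega), h0 (L + 2) (by omega), zero_mul, zero_mul, add_zero, add_zero,
      PiLp.smul_apply, Matrix.ofLp_toEuclideanCLM, Matrix.sum_mulVec, Finset.sum_apply,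
      Finset.smul_sum]
    refine Finset.sum_congr rfl fun i hi => ?_
    have hi' : i ≤ L := Nat.lt_succ_iff.1 (Finset.mem_range.1 hi)
    rw [← Complex.ofReal_mul, huv i hi', min_eq_right hi', ← hwA A hAs i]
    simp only [Matrix.smul_mulVec, Pi.smul_apply, smul_eq_mul]
    push_cast
    ring
  · intro i hi
    rw [← Complex.ofReal_mul, huv0 i (by omega), Complex.ofReal_zero, zero_mul]
  · obtain ⟨a, ha, rfl⟩ := O.nonzero_mem j k hjk
    rw [Equiv.symm_apply_apply]
    exact Finset.mem_filter.2 ⟨Finset.mem_univ _, lt_max_of_lt_left ha⟩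

/-! ### The approximation of `f(A)` -/

theorem two_pow_le_factorial_succ (L : ℕ) : 2 ^ L ≤ (L + 1).factorial := by
  induction L with
  | zero => simp
  | succ L ih =>
    rw [pow_succ', Nat.factorial_succ]
    exact Nat.mul_le_mul (by omega) ih

theorem div_factorial_lt {C ε : ℝ} {L : ℕ} (hC : 0 < C) (hε : 0 < ε)
    (h : Real.logb 2 (C / ε) < L) : C / ((L + 1).factorial : ℝ) < ε := by
  rw [Real.logb_lt_iff_lt_rpow (by norm_num) (by positivity), Real.rpow_natCast,
    div_lt_iff₀ hε] at h
  rw [div_lt_iff₀ (by positivity), mul_comm]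
  refine h.trans_le ?_
  gcongr
  exact_mod_cast two_pow_le_factorial_succ L

/-- A pointwise bound `|f| ≤ |g| + δ` on the spectrum carries over to norms. -/
theorem Matrix.IsHermitian.norm_cfc_le_add {ι : Type} [Fintype ι] [DecidableEq ι]
    {A : Matrix ι ι ℂ} (hA : A.IsHermitian) {f g : ℝ → ℝ} {δ : ℝ} (hδ : 0 ≤ δ)
    (h : ∀ i, |f (hA.eigenvalues i)| ≤ |g (hA.eigenvalues i)| + δ) (v : EuclideanSpace ℂ ι) :
    ‖Matrix.toEuclideanCLM (𝕜 := ℂ) (hA.cfc f) v‖ ≤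
      ‖Matrix.toEuclideanCLM (𝕜 := ℂ) (hA.cfc g) v‖ + δ * ‖v‖ := by
  calc _ ≤ ‖Matrix.toEuclideanCLM (𝕜 := ℂ) (hA.cfc fun x => |g x| - -δ) v‖ :=
        hA.norm_cfc_le (fun i => by
          rw [sub_neg_eq_add, abs_of_nonneg (a := _ + δ) (by positivity)]
          exact h i) v
    _ = ‖Matrix.toEuclideanCLM (𝕜 := ℂ) (hA.cfc fun x => |g x|) v + (δ : ℂ) • v‖ := by
        rw [hA.cfc_sub', hA.cfc_const', map_sub, map_smul, map_one, Complex.ofReal_neg]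
        change ‖_ - -(δ : ℂ) • v‖ = _
        rw [neg_smul, sub_neg_eq_add]
        rfl
    _ ≤ ‖Matrix.toEuclideanCLM (𝕜 := ℂ) (hA.cfc fun x => |g x|) v‖ + δ * ‖v‖ := by
        refine (norm_add_le _ _).trans_eq ?_
        rw [norm_smul, Complex.norm_real, Real.norm_of_nonneg hδ]
    _ ≤ _ := by
        gcongr
        exact hA.norm_cfc_le (fun i => by rw [abs_abs]) v

theorem Matrix.IsHermitian.norm_cfc_const {ι : Type} [Fintype ι] [DecidableEq ι]
    {A : Matrix ι ι ℂ} (hA : A.IsHermitian) {r : ℝ} (hr : 0 ≤ r) (v : EuclideanSpace ℂ ι) :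
    ‖Matrix.toEuclideanCLM (𝕜 := ℂ) (hA.cfc fun _ => r) v‖ = r * ‖v‖ := by
  rw [hA.cfc_const', map_smul, map_one, _root_.smul_apply,
    one_apply_eq_self, norm_smul, Complex.norm_real, Real.norm_of_nonneg hr]

theorem infAbs_nonneg (f : ℝ → ℝ) : 0 ≤ infAbs f :=
  Real.sInf_nonneg (by rintro _ ⟨x, -, rfl⟩; exact abs_nonneg _)

theorem normalize_smul {E : Type*} [NormedAddCommGroup E] [NormedSpace ℂ E] {r : ℝ} (hr : 0 < r)
    (u : E) : ((‖(r : ℂ) • u‖⁻¹ : ℝ) : ℂ) • (r : ℂ) • u = ((‖u‖⁻¹ : ℝ) : ℂ) • u := by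
  rw [smul_smul, norm_smul, Complex.norm_real, Real.norm_of_nonneg hr.le, ← Complex.ofReal_mul]
  congr 2
  field_simp

theorem theorem1 :
    ∃ (K : ℕ) (c : ℝ), ∀ (n d m : ℕ) (val : Bits m → ℂ) (f : ℝ → ℝ) (C ε : ℝ) (L : ℕ),
      ContDiffOn ℝ ∞ f (Set.Icc (-1) 1) →
      0 < C →
      (∀ i : ℕ, 1 ≤ i → ∀ x ∈ Set.Ioo (-1 : ℝ) 1, |iteratedDeriv i f x| ≤ C) →
      0 < ε →
      Real.logb 2 (C / ε) < L →
      ∃ (t : ℕ) (circ : List (Gate n m t)),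
        queryCount circ ≤ K * L ∧
        ∀ (A : Matrix (Bits n) (Bits n) ℂ) (hA : A.IsHermitian),
          IsRowSparse d A →
          ‖Matrix.toEuclideanCLM (𝕜 := ℂ) A‖ ≤ 1 →
          ∀ (O : SparseOracle d val A) (ψ : EuclideanSpace ℂ (Bits n)),
            ‖ψ‖ = 1 →
            (infAbs f / coeffWeight f d L) ^ 2 ≤ outcomeProb (circuitUnitary O circ) 0 ψ ∧
            (‖Matrix.toEuclideanCLM (𝕜 := ℂ) (hA.cfc f) ψ‖ - ε) / coeffWeight f d L ≤
              √(outcomeProb (circuitUnitary O circ) 0 ψ) ∧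
            (Matrix.toEuclideanCLM (𝕜 := ℂ) (hA.cfc f) ψ ≠ 0 →
              ‖postState (circuitUnitary O circ) 0 ψ -
                  ((‖Matrix.toEuclideanCLM (𝕜 := ℂ) (hA.cfc f) ψ‖⁻¹ : ℝ) : ℂ) •
                    Matrix.toEuclideanCLM (𝕜 := ℂ) (hA.cfc f) ψ‖ ≤
                c * ε / ‖Matrix.toEuclideanCLM (𝕜 := ℂ) (hA.cfc f) ψ‖) := by
  refine ⟨4, 6, fun n d m val f C ε L hf hC hfC hε hL => ?_⟩
  set δ : ℝ := C / ((L + 1).factorial : ℝ) with hδdef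
  have hδ : 0 ≤ δ := by positivity
  have hδε : δ < ε := div_factorial_lt hC hε hL
  obtain ⟨b, hb, hb'⟩ := exists_corrected_coeff (f := f) (α := maclaurinCoeff f) (d := d) (L := L)
    hδ hf.continuousOn (by simp [maclaurinCoeff])
    fun x hx => abs_sub_maclaurin_le hf hfC hC.le L hx
  set γ := coeffWeight f d L with hγdef
  change _ ≤ γ at hb
  set g : ℝ → ℝ := fun x => ∑ i ∈ Finset.range (L + 1), b i * x ^ i with hg
  have hγ0 : 0 ≤ γ := Finset.sum_nonneg fun i _ => by positivity
  -- On the spectrum of `A`, the polynomial `g` has the properties provided by the choice of `b`.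
  have hspec : ∀ (A : Matrix (Bits n) (Bits n) ℂ) (hA : A.IsHermitian), IsRowSparse d A →
      ‖Matrix.toEuclideanCLM (𝕜 := ℂ) A‖ ≤ 1 → ∀ i,
      hA.eigenvalues i ∈ Set.Icc (-1 : ℝ) 1 ∧ |hA.eigenvalues i| ≤ d := by
    intro A hA hAs hA1 i
    have h1 := hA.abs_eigenvalues_le hA1 i
    refine ⟨abs_le.1 h1, ?_⟩
    rcases Nat.eq_zero_or_pos d with rfl | hd
    · have h0 : ‖Matrix.toEuclideanCLM (𝕜 := ℂ) A‖ ≤ 0 := by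
        rw [eq_zero_of_isRowSparse_zero hAs]
        simp
      simpa using hA.abs_eigenvalues_le h0 i
    · exact h1.trans (by exact_mod_cast hd)
  rcases hγ0.eq_or_lt with hγ | hγ
  · -- All coefficients that matter vanish, so that `f(A)` itself is of size at most `δ`.
    refine ⟨0, [], by simp [queryCount], fun A hA hAs hA1 O ψ hψ => ⟨?_, ?_, fun hne => ?_⟩⟩
    · rw [← hγ, div_zero, zero_pow two_ne_zero]
      exact sq_nonneg _
    · rw [← hγ, div_zero]
      exact Real.sqrt_nonneg _
    · have hsmall : ‖Matrix.toEuclideanCLM (𝕜 := ℂ) (hA.cfc f) ψ‖ ≤ ε := by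
        have h0 : ∀ i, g (hA.eigenvalues i) = 0 := fun i => by
          rw [← abs_nonpos_iff, hγ]
          refine le_trans (Finset.abs_sum_le_sum_abs _ _) (le_trans
            (Finset.sum_le_sum fun j _ => ?_) hb)
          rw [abs_mul, abs_pow, mul_comm]
          gcongr
          exact (hspec A hA hAs hA1 i).2
        have h1 := hA.norm_cfc_le_add (f := f) (g := fun _ => 0) hδ (fun i => by
          have h := (hb' _ (hspec A hA hAs hA1 i).1 (hspec A hA hAs hA1 i).2).2.1
          rwa [show (∑ j ∈ Finset.range (L + 1), b j * hA.eigenvalues i ^ j) = 0 from h0 i] at h) ψ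
        rw [hA.norm_cfc_const le_rfl, hψ] at h1
        linarith
      have hunit : ∀ u : EuclideanSpace ℂ (Bits n), ‖((‖u‖⁻¹ : ℝ) : ℂ) • u‖ ≤ 1 := fun u => by
        rw [norm_smul, Complex.norm_real, norm_inv, norm_norm]
        exact inv_mul_le_one
      rw [le_div_iff₀ (norm_pos_iff.2 hne)]
      calc _ ≤ 2 * ε := by
            refine mul_le_mul ((norm_sub_le _ _).trans ?_) hsmall (norm_nonneg _) (by norm_num)
            exact (add_le_add (hunit (branch (circuitUnitary O []) 0 ψ)) (hunit _)).trans_eq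
              one_add_one_eq_two
        _ ≤ 6 * ε := by linarith
  · obtain ⟨t, circ, hq, hcirc⟩ := exists_circuit_polynomial n d m val b L hγ hb
    refine ⟨t, circ, hq.le, fun A hA hAs hA1 O ψ hψ => ?_⟩
    have hbr := hcirc A hA hAs
      (fun j k => (A.norm_apply_le_norm_toEuclideanCLM j k).trans hA1) O ψ
    rw [← hA.cfc_polynomial b (L + 1)] at hbr
    have hsp := fun i => hb' _ (hspec A hA hAs hA1 i).1 (hspec A hA hAs hA1 i).2
    set fψ := Matrix.toEuclideanCLM (𝕜 := ℂ) (hA.cfc f) ψ with hfψ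
    set gψ := Matrix.toEuclideanCLM (𝕜 := ℂ) (hA.cfc g) ψ with hgψ
    have hlow : infAbs f ≤ ‖gψ‖ := by
      have h := hA.norm_cfc_le (g := fun _ => infAbs f) (h := g)
        (fun i => by
          rw [abs_of_nonneg (infAbs_nonneg f)]
          exact (hsp i).1) ψ
      rwa [hA.norm_cfc_const (infAbs_nonneg f), hψ, mul_one] at h
    have hupp : ‖fψ‖ ≤ ‖gψ‖ + δ := by
      simpa [hψ] using hA.norm_cfc_le_add hδ (fun i => (hsp i).2.1) ψ
    have hdist : ‖gψ - fψ‖ ≤ 3 * δ := by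
      have h := hA.norm_cfc_le (g := fun x => g x - f x) (h := fun _ => 3 * δ)
        (fun i => by
          rw [abs_of_nonneg (a := 3 * δ) (by positivity)]
          exact (hsp i).2.2) ψ
      rwa [hA.norm_cfc_const (by positivity), hψ, mul_one, hA.cfc_sub', map_sub] at h
    have hnorm : ‖branch (circuitUnitary O circ) 0 ψ‖ = ‖gψ‖ / γ := by
      rw [hbr, norm_smul, Complex.norm_real, Real.norm_of_nonneg (by positivity), div_eq_inv_mul]
    refine ⟨?_, ?_, fun hne => ?_⟩
    · rw [outcomeProb, hnorm]
      have := infAbs_nonneg f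
      gcongr
    · rw [outcomeProb, Real.sqrt_sq (norm_nonneg _), hnorm]
      gcongr
      linarith
    · rw [postState, hbr, normalize_smul (inv_pos.2 hγ)]
      refine (norm_normalize_sub_le gψ fψ hne).trans ?_
      exact div_le_div_of_nonneg_right (by linarith) (norm_nonneg _)

end
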